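/- Let $(M,g)$ be a smooth Riemannian manifold without boundary (Hausdorff, second countable, of dimension $d\ge 0$, not necessarily compact), let $dy$ be its Riemannian volume and let $L^2(M)$ be the Hilbert space of real- or complex-valued square-integrable functions. A bounded operator $S$ on $L^2(M)$ is called a \emph{smoothing operator} if there is a function $K_S\in C^\infty(M\times M)$, its \emph{kernel}, such that $K_S(x,\cdot)$ and $K_S(\cdot,x)$ are in $L^2(M)$ for every $x\in M$, such that for all $u\in L^2(M)$ \[ (Su)(x)=\int_M K_S(x,y)\,u(y)\,dy,\qquad (S^{*}u)(x)=\int_M \overline{K_S(y,x)}\,u(y)\,dy \] for almost every $x$, and such that the right-hand sides are $C^\infty$ functions of $x\in M$ (so $S$ and $S^*$ map $L^2(M)$ into $C^\infty(M)$). For a compact set $U\subset M\times M$, $k\in\mathbb{N}$ and $v\in C^\infty(M\times M)$ let \[ p_{U,k}(v)=\sup_{(x,y)\in U}|\nabla^k v(x,y)|, \] where $\nabla$ is the Levi-Civita connection of the Riemannian product $(M\times M,g\oplus g)$ acting on covariant tensor fields and $|\cdot|$ is the norm on covariant tensors induced by $g\oplus g$. For any exhaustion $\{U_j\}_{j\in\mathbb{N}}$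 of $M\times M$ by compact subsets ($U_j\subset \operatorname{int}U_{j+1}$, $\bigcup_j U_j=M\times M$) give $C^\infty(M\times M)$ the Fréchet topology of the seminorms $p_{U_j,k}$, $j,k\in\mathbb{N}$. Let $S$ be a compact smoothing operator on $L^2(M)$ with operator norm $\|S\|<1$. Then: (1) for every $n\ge 1$ the operator $S^n$ is a smoothing operator, and its kernel $K_{S^n}\in C^\infty(M\times M)$ is unique; (2) the series $S'=\sum_{n\ge1}S^n$ converges in operator norm, and $I+S'$ is the two-sided inverse of $I-S$, i.e. $(I-S)^{-1}=I+S'$; (3) $S'$ is a smoothing operator, and the series $\sum_{n\ge 1}K_{S^n}$ converges in $C^\infty(M\times M)$ to a kernel $K_{S'}$ of $S'$. -/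

import Mathlib

open Set Filter Topology MeasureTheory Manifold Bundle
open scoped ENNReal ContDiff ComplexConjugate

noncomputable section

namespace NeumannSmoothing

/-! ### Covariant derivatives of functions on a Riemannian manifold

`N` is a manifold without boundary, modelled on the finite-dimensional space `F`, and `B` is a
(smooth) field of inner products on its tangent spaces. -/

section Covariant

variable {F : Type*} [NormedAddCommGroup F] [NormedSpace ℝ F]
  {H : Type*} [TopologicalSpace H] (I : ModelWithCorners ℝ F H)
  {N : Type*} [TopologicalSpace N] [ChartedSpace H N]
  {𝕜 : Type*} [RCLike 𝕜]

/-- The coordinate expression, in the preferred chart `φ` around `p`, of the field `B` of bilinear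
forms on tangent spaces: `(u, w) ↦ B (Dφ⁻¹ u, Dφ⁻¹ w)` at `φ⁻¹ y`, for `y` in the target of `φ`.
(All tangent spaces are copies of the model space `F`.) -/
def chartMetric (B : ∀ q : N, TangentSpace I q →L[ℝ] TangentSpace I q →L[ℝ] ℝ) (p : N) (y : F) :
    F →L[ℝ] F →L[ℝ] ℝ :=
  let A : F →L[ℝ] F := mfderiv 𝓘(ℝ, F) I (extChartAt I p).symm y
  let b : F →L[ℝ] F →L[ℝ] ℝ := B ((extChartAt I p).symm y)
  b.bilinearComp A A

/-- The Christoffel symbols `Γ y (u, w)` of the Levi-Civita connection of a metric `G` on (an open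
subset of) `F`, i.e. the vector determined by
`2 G(Γ(u, w), z) = (D_u G)(w, z) + (D_w G)(u, z) - (D_z G)(u, w)` for all `z`. -/
def christoffel (G : F → F →L[ℝ] F →L[ℝ] ℝ) (y u w : F) : F :=
  (G y).inverse ((1 / 2 : ℝ) •
    (fderiv ℝ G y u w + fderiv ℝ G y w u - ((fderiv ℝ G y).flip u).flip w))

/-- The `k`-th covariant derivative `∇ᵏ f` of a function `f` on (an open subset of) `F`, a covariant
`k`-tensor field, for the Levi-Civita connection of the metric `G`:
`(∇ᵏ⁺¹ f)(w₀, …, w_k) = D_{w₀} (∇ᵏ f (w₁, …, w_k)) - ∑ᵢ ∇ᵏ f (w₁, …, Γ(w₀, wᵢ), …, w_k)`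
for constant vector fields `w₀, …, w_k`. -/
def iteratedCovDeriv (G : F → F →L[ℝ] F →L[ℝ] ℝ) (f : F → 𝕜) :
    (k : ℕ) → F → (Fin k → F) → 𝕜
  | 0, y, _ => f y
  | k + 1, y, w =>
      fderiv ℝ (fun z => iteratedCovDeriv G f k z (Fin.tail w)) y (w 0) -
        ∑ i : Fin k, iteratedCovDeriv G f k y
          (Function.update (Fin.tail w) i (christoffel G y (w 0) (Fin.tail w i)))

/-- The pointwise norm `|∇ᵏ v|` at `p`, computed in the preferred chart around `p`. The norm of
a covariant tensor `T` is `(∑ |T(e_{i₁}, …, e_{i_k})|²)^{1/2}` for an orthonormal basis `e` of the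
tangent space; all orthonormal bases give the same value, and so the supremum over them
is that value. -/
def covDerivNorm (B : ∀ q : N, TangentSpace I q →L[ℝ] TangentSpace I q →L[ℝ] ℝ) (v : N → 𝕜)
    (k : ℕ) (p : N) : ℝ≥0∞ :=
  ⨆ e : {e : Fin (Module.finrank ℝ F) → F // ∀ i j,
      chartMetric I B p (extChartAt I p p) (e i) (e j) = if i = j then 1 else 0},
    ENNReal.ofReal (Real.sqrt (∑ i : Fin k → Fin (Module.finrank ℝ F),
      ‖iteratedCovDeriv (chartMetric I B p) (v ∘ (extChartAt I p).symm) k (extChartAt I p p)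
        (fun a => e.1 (i a))‖ ^ 2))

/-- The seminorm `sup_{p ∈ U} |∇ᵏ v|`. -/
def smoothSeminorm (B : ∀ q : N, TangentSpace I q →L[ℝ] TangentSpace I q →L[ℝ] ℝ) (U : Set N)
    (k : ℕ) (v : N → 𝕜) : ℝ≥0∞ :=
  ⨆ p ∈ U, covDerivNorm I B v k p

end Covariant

/-! ### Riemannian volume, product metric and smoothing operators -/

section Operators

variable {d : ℕ} {M : Type*} [TopologicalSpace M] [ChartedSpace (EuclideanSpace ℝ (Fin d)) M]
  [IsManifold (𝓡 d) ∞ M]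

/-- Smooth Riemannian metrics on the `d`-dimensional manifold `M`. -/
abbrev Metric (d : ℕ) (M : Type*) [TopologicalSpace M]
    [ChartedSpace (EuclideanSpace ℝ (Fin d)) M] [IsManifold (𝓡 d) ∞ M] :=
  ContMDiffRiemannianMetric (𝓡 d) ∞ (EuclideanSpace ℝ (Fin d))
    (fun x : M => TangentSpace (𝓡 d) x)

/-- The Riemannian product metric `g ⊕ g` on `M × M`. -/
def prodMetric (g : Metric d M) (p : M × M) :
    TangentSpace ((𝓡 d).prod (𝓡 d)) p →L[ℝ] TangentSpace ((𝓡 d).prod (𝓡 d)) p →L[ℝ] ℝ :=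
  let π₁ : EuclideanSpace ℝ (Fin d) × EuclideanSpace ℝ (Fin d) →L[ℝ] EuclideanSpace ℝ (Fin d) :=
    ContinuousLinearMap.fst ℝ _ _
  let π₂ : EuclideanSpace ℝ (Fin d) × EuclideanSpace ℝ (Fin d) →L[ℝ] EuclideanSpace ℝ (Fin d) :=
    ContinuousLinearMap.snd ℝ _ _
  let g₁ : EuclideanSpace ℝ (Fin d) →L[ℝ] EuclideanSpace ℝ (Fin d) →L[ℝ] ℝ := g.inner p.1
  let g₂ : EuclideanSpace ℝ (Fin d) →L[ℝ] EuclideanSpace ℝ (Fin d) →L[ℝ] ℝ := g.inner p.2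
  g₁.bilinearComp π₁ π₁ + g₂.bilinearComp π₂ π₂

variable [MeasurableSpace M]

/-- The Riemannian volume on the domain of the preferred chart around `x`, extended by zero: in
coordinates it is `√(det gᵢⱼ) dy`. -/
def chartVolume (g : Metric d M) (x : M) : Measure M :=
  ((volume.restrict (extChartAt (𝓡 d) x).target).withDensity fun y =>
    ENNReal.ofReal (Real.sqrt (Matrix.of fun i j : Fin d =>
      chartMetric (𝓡 d) g.inner x y (EuclideanSpace.single i 1) (EuclideanSpace.single j 1)).det)).map
    (extChartAt (𝓡 d) x).symm

/-- The Riemannian volume measure of `(M, g)`. The chart volumes agree on the overlaps of charts,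
so the measure that they glue to is the least measure which dominates all of them. -/
def riemannianVolume (g : Metric d M) : Measure M :=
  ⨆ x : M, chartVolume g x

/-- The Hilbert space `L²(M)` of real or complex functions, for the Riemannian volume. -/
abbrev L2 (𝕜 : Type*) [RCLike 𝕜] (g : Metric d M) :=
  Lp 𝕜 2 (riemannianVolume g)

variable {𝕜 : Type*} [RCLike 𝕜]

/-- `S` maps `L²(M)` into `C^∞(M)` and is the integral operator
`(S u)(x) = ∫ K(x, y) u(y) dy` (with an absolutely convergent integral for all `x` and
`u ∈ L²(M)`). -/
structure IsIntegralOperatorIntoSmooth (g : Metric d M) (K : M → M → 𝕜)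
    (S : L2 𝕜 g →L[𝕜] L2 𝕜 g) : Prop where
  memLp : ∀ x, MemLp (K x) 2 (riemannianVolume g)
  ae_eq : ∀ u : L2 𝕜 g,
    S u =ᵐ[riemannianVolume g] fun x => ∫ y, K x y * u y ∂riemannianVolume g
  contMDiff : ∀ u : L2 𝕜 g,
    ContMDiff (𝓡 d) 𝓘(ℝ, 𝕜) ∞ fun x => ∫ y, K x y * u y ∂riemannianVolume g

/-- The space `C^∞(M × M)`. -/
abbrev SmoothKernel (𝕜 : Type*) [RCLike 𝕜] (d : ℕ) (M : Type*) [TopologicalSpace M]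
    [ChartedSpace (EuclideanSpace ℝ (Fin d)) M] :=
  C^∞⟮(𝓡 d).prod (𝓡 d), M × M; 𝓘(ℝ, 𝕜), 𝕜⟯

/-- `K ∈ C^∞(M × M)` is the kernel of the smoothing operator `S`: `S` and its adjoint are the
integral operators with kernels `K(x, y)` and `conj K(y, x)`, and both map `L²(M)` into
`C^∞(M)`. -/
structure IsSmoothingKernel (g : Metric d M) (K : SmoothKernel 𝕜 d M)
    (S : L2 𝕜 g →L[𝕜] L2 𝕜 g) : Prop where
  self : IsIntegralOperatorIntoSmooth g (fun x y => K (x, y)) S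
  adjoint : IsIntegralOperatorIntoSmooth g (fun x y => conj (K (y, x)))
    (ContinuousLinearMap.adjoint S)

/-- Smoothing operators on `L²(M)`. -/
def IsSmoothing (g : Metric d M) (S : L2 𝕜 g →L[𝕜] L2 𝕜 g) : Prop :=
  ∃ K : SmoothKernel 𝕜 d M, IsSmoothingKernel g K S

/-- Convergence `v n → v∞` in `C^∞(M × M)`, for the topology of the seminorms
`p_{j,k}(v) = sup_{U j} |∇ᵏ v|`, where `U` is an exhaustion of `M × M` by compact sets and `∇` is
the Levi-Civita connection of `g ⊕ g`. -/
def TendstoSmooth (g : Metric d M) (U : CompactExhaustion (M × M)) (v : ℕ → SmoothKernel 𝕜 d M)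
    (vlim : SmoothKernel 𝕜 d M) : Prop :=
  ∀ j k : ℕ, Tendsto
    (fun n => smoothSeminorm ((𝓡 d).prod (𝓡 d)) (prodMetric g) (U j) k (⇑(v n - vlim)))
    atTop (𝓝 0)

end Operators

end NeumannSmoothing

end

noncomputable section

set_option maxSynthPendingDepth 3

namespace NeumannSmoothing

/-! ### Pointwise smooth families of functionals are smooth in norm -/

section WeakSmoothness

variable {𝕜 : Type*} [RCLike 𝕜] {V : Type*} [NormedAddCommGroup V] [NormedSpace 𝕜 V]
  [CompleteSpace V] {E : Type*} [NormedAddCommGroup E] [NormedSpace ℝ E]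

/-! Write `a x` and `b y` for the vectors of `L²(M)` representing `u ↦ (S u)(x)` and `u ↦ (S*
u)(y)`. For any bounded `R`, the operator `S R S` has kernel `⟨a x, R (b y)⟩`. Since `S ^ (n + 2) =
S * S ^ n * S`, all higher powers have this form, and with `Q = ∑ S ^ n` the sum of the Neumann
series is `S * Q = S + S * Q * S`. It remains to see that the kernel of `S R S` depends continuously
on `R`, from the operator norm to `C^∞(M × M)`.

The hypothesis that every `S u` and `S* u` is smooth says that `a` and `b` are weakly smooth. By
Banach-Steinhaus a pointwise smooth family of functionals on a Banach space is smooth in norm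
(`contMDiff_of_pointwise`). Hence `a` and `b` are smooth maps into `L²(M)`. Applied once more, on `M
× M`, the same principle makes `(x, y) ↦ (R ↦ ⟨a x, R (b y)⟩)` a smooth map into the dual of the
space of bounded operators. Covariant derivatives commute with the evaluation at `R`, so on a
compact set each seminorm of the kernel is at most `C * ‖R‖` (`exists_smoothSeminorm_sandwich_le`).
Norm convergence of the partial sums of `∑ S ^ n` then gives convergence of the kernels.

The seminorms use a different chart at each point. Naturality of covariant derivatives
(`IsSmoothMetricOn.covTensor_comp`) moves the computation to one fixed chart, where compactness
gives the bounds. Kernels are unique because the Riemannian volume charges every nonempty open set.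
-/

/-- A family of functionals that is pointwise differentiable at `x` is norm continuous at `x`. -/
theorem continuousAt_of_pointwise_differentiableAt {f : E → V →L[𝕜] 𝕜} {x : E}
    (hf : ∀ u, DifferentiableAt ℝ (fun z => f z u) x) : ContinuousAt f x := by
  rw [ContinuousAt, tendsto_iff_seq_tendsto]
  intro s hs
  -- Pointwise differentiability bounds the difference quotients along `s` on each `u`, so they are
  -- uniformly bounded. Where `s n = x` the inverse is `0` and so is the quotient.
  have hbs : ∃ C, ∀ n, ‖((‖s n - x‖⁻¹ : ℝ) : 𝕜) • (f (s n) - f x)‖ ≤ C := by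
    refine banach_steinhaus fun u => ?_
    have h1 : (fun n => f (s n) u - f x u) =O[atTop] fun n => s n - x :=
      (hf u).hasFDerivAt.isBigO_sub.comp_tendsto hs
    obtain ⟨C, hC0, hC⟩ := Asymptotics.bound_of_isBigO_nat_atTop h1
    refine ⟨C, fun n => ?_⟩
    by_cases hn : s n - x = 0
    · simp [hn, hC0.le]
    · have := hC hn
      have hpos : 0 < ‖s n - x‖ := norm_pos_iff.2 hn
      simp only [smul_apply, sub_apply, norm_smul,
        RCLike.norm_ofReal, abs_inv, abs_norm]
      rw [inv_mul_le_iff₀ hpos]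
      linarith
  obtain ⟨C, hC⟩ := hbs
  have hle : ∀ n, ‖f (s n) - f x‖ ≤ C * ‖s n - x‖ := by
    intro n
    by_cases hn : s n - x = 0
    · have : s n = x := sub_eq_zero.1 hn
      simp [this]
    · have hpos : 0 < ‖s n - x‖ := norm_pos_iff.2 hn
      have := hC n
      rw [norm_smul, RCLike.norm_ofReal, abs_inv, abs_norm, inv_mul_le_iff₀ hpos] at this
      linarith
  rw [tendsto_iff_norm_sub_tendsto_zero]
  refine squeeze_zero (fun _ => norm_nonneg _) hle ?_
  have := (tendsto_iff_norm_sub_tendsto_zero.1 hs).const_mul C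
  simpa using this

variable [FiniteDimensional ℝ E]

/-- The pointwise derivative of a pointwise differentiable family of functionals is a linear map
into the space of functionals. -/
theorem exists_pointwise_fderiv {f : E → V →L[𝕜] 𝕜} {x : E}
    (hf : ∀ u, DifferentiableAt ℝ (fun z => f z u) x) :
    ∃ f' : E →L[ℝ] V →L[𝕜] 𝕜, ∀ h u, f' h u = fderiv ℝ (fun z => f z u) x h := by
  have key : ∀ h : E, ∃ L : V →L[𝕜] 𝕜, ∀ u, L u = fderiv ℝ (fun z => f z u) x h := by
    intro h
    -- Difference quotients with step `1 / n`: a pointwise limit of a sequence of bounded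
    -- functionals is bounded, again by Banach-Steinhaus.
    let c : ℕ → ℝ := fun n => n
    have ht : Tendsto (fun n (u : V) => ((c n : 𝕜) • (f (x + (c n)⁻¹ • h) - f x)) u) atTop
        (𝓝 fun u => fderiv ℝ (fun z => f z u) x h) := by
      rw [tendsto_pi_nhds]
      intro u
      have := (hf u).hasFDerivAt.lim h (c := c) (l := atTop)
        (tendsto_norm_atTop_atTop.comp tendsto_natCast_atTop_atTop)
      simpa [RCLike.real_smul_eq_coe_mul] using this
    exact ⟨continuousLinearMapOfTendsto _ ht, fun u => rfl⟩
  choose L hL using key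
  let L' : E →ₗ[ℝ] V →L[𝕜] 𝕜 :=
    { toFun := L
      map_add' := fun a b => by ext u; simp [hL]
      map_smul' := fun a b => by ext u; simp [hL] }
  exact ⟨LinearMap.toContinuousLinearMap L', fun h u => hL h u⟩

/-- A family of functionals that is pointwise `C^∞` on an open set has a norm derivative there,
which is again pointwise `C^∞`. -/
theorem hasFDerivAt_of_pointwise_contDiffOn {f : E → V →L[𝕜] 𝕜} {O : Set E} (hO : IsOpen O)
    (hf : ∀ u, ContDiffOn ℝ ∞ (fun z => f z u) O) :
    ∃ f' : E → E →L[ℝ] V →L[𝕜] 𝕜, (∀ x ∈ O, HasFDerivAt f (f' x) x) ∧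
      ∀ h u, ContDiffOn ℝ ∞ (fun z => f' z h u) O := by
  have hd : ∀ x ∈ O, ∀ u, DifferentiableAt ℝ (fun z => f z u) x := fun x hx u =>
    ((hf u).contDiffAt (hO.mem_nhds hx)).differentiableAt (by simp)
  have hex : ∀ x, ∃ f' : E →L[ℝ] V →L[𝕜] 𝕜,
      x ∈ O → ∀ h u, f' h u = fderiv ℝ (fun z => f z u) x h := by
    intro x
    by_cases hx : x ∈ O
    · obtain ⟨f', h⟩ := exists_pointwise_fderiv (hd x hx)
      exact ⟨f', fun _ => h⟩
    · exact ⟨0, fun h => absurd h hx⟩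
  choose f' hf' using hex
  have hsm : ∀ h u, ContDiffOn ℝ ∞ (fun z => f' z h u) O := by
    intro h u
    have h1 : ContDiffOn ℝ ∞ (fun z => fderiv ℝ (fun y => f y u) z h) O :=
      ((hf u).fderiv_of_isOpen hO (by simp)).clm_apply contDiffOn_const
    exact h1.congr fun z hz => hf' z hz h u
  refine ⟨f', fun x hx => ?_, hsm⟩
  -- As `E` is finite-dimensional, continuity can be tested on each direction `h`, and `z ↦ f' z h`
  -- is itself pointwise differentiable.
  have hcont : ContinuousAt f' x := by
    have : ContinuousOn f' O := by
      rw [continuousOn_clm_apply]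
      intro h z hz
      refine (continuousAt_of_pointwise_differentiableAt fun u => ?_).continuousWithinAt
      exact ((hsm h u).contDiffAt (hO.mem_nhds hz)).differentiableAt (by simp)
    exact this.continuousAt (hO.mem_nhds hx)
  rw [hasFDerivAt_iff_isLittleO, Asymptotics.isLittleO_iff]
  intro ε hε
  obtain ⟨r, hr, hball⟩ := Metric.mem_nhds_iff.1
    (inter_mem (hO.mem_nhds hx) (hcont (Metric.closedBall_mem_nhds (f' x) hε)))
  filter_upwards [Metric.ball_mem_nhds x hr] with y hy
  -- The mean value inequality is applied for each `u` on one ball where `f'` varies by at most `ε`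
  -- in norm; the error `ε * ‖u‖ * ‖y - x‖` is then uniform in `u`.
  refine ContinuousLinearMap.opNorm_le_bound _ (by positivity) fun u => ?_
  let ev : (V →L[𝕜] 𝕜) →L[ℝ] 𝕜 :=
    (ContinuousLinearMap.apply 𝕜 𝕜 u).restrictScalars ℝ
  have := Convex.norm_image_sub_le_of_norm_hasFDerivWithin_le' (𝕜 := ℝ)
    (f := fun z => f z u) (f' := fun z => ev ∘L f' z) (φ := ev ∘L f' x) (C := ε * ‖u‖)
    (s := Metric.ball x r) (x := x) (y := y) ?_ ?_ (convex_ball x r)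
    (Metric.mem_ball_self hr) hy
  · simp only [sub_apply]
    calc _ ≤ ε * ‖u‖ * ‖y - x‖ := this
      _ = _ := by ring
  · intro z hz
    have hzO := (hball hz).1
    have heq : ev ∘L f' z = fderiv ℝ (fun y => f y u) z := by
      ext h
      exact hf' z hzO h u
    rw [heq]
    exact (hd z hzO u).hasFDerivAt.hasFDerivWithinAt
  · intro z hz
    have hzε : ‖f' z - f' x‖ ≤ ε := by
      have h3 := (hball hz).2
      have h4 := dist_eq_norm (f' z) (f' x)
      rw [← h4]
      exact h3
    refine ContinuousLinearMap.opNorm_le_bound _ (by positivity) fun h => ?_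
    calc ‖((f' z - f' x) h) u‖ ≤ ‖(f' z - f' x) h‖ * ‖u‖ := ContinuousLinearMap.le_opNorm _ _
      _ ≤ (‖f' z - f' x‖ * ‖h‖) * ‖u‖ := by gcongr; exact ContinuousLinearMap.le_opNorm _ _
      _ ≤ (ε * ‖h‖) * ‖u‖ := by gcongr
      _ = _ := by ring

/-- A family of functionals that is pointwise `C^∞` on an open set is `C^∞` in norm. -/
theorem contDiffOn_of_pointwise {f : E → V →L[𝕜] 𝕜} {O : Set E} (hO : IsOpen O)
    (hf : ∀ u, ContDiffOn ℝ ∞ (fun z => f z u) O) : ContDiffOn ℝ ∞ f O := by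
  rw [contDiffOn_infty]
  intro n
  -- `f` is generalized because the induction passes to the directional derivatives `z ↦ f' z h`,
  -- which are again pointwise smooth.
  induction n generalizing f with
  | zero =>
    obtain ⟨f', h1, -⟩ := hasFDerivAt_of_pointwise_contDiffOn hO hf
    exact contDiffOn_zero.2 fun x hx => (h1 x hx).continuousAt.continuousWithinAt
  | succ n ih =>
    obtain ⟨f', h1, h2⟩ := hasFDerivAt_of_pointwise_contDiffOn hO hf
    push_cast
    rw [contDiffOn_succ_iff_fderiv_of_isOpen hO]
    refine ⟨fun x hx => (h1 x hx).differentiableAt.differentiableWithinAt, by simp, ?_⟩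
    rw [contDiffOn_clm_apply]
    intro h
    refine (ih (h2 h)).congr fun x hx => ?_
    rw [(h1 x hx).fderiv]

/-- A family of functionals on a manifold that is pointwise `C^∞` is `C^∞` in norm. -/
theorem contMDiff_of_pointwise {H : Type*} [TopologicalSpace H] {I : ModelWithCorners ℝ E H}
    [I.Boundaryless] {N : Type*} [TopologicalSpace N] [ChartedSpace H N] [IsManifold I ∞ N]
    {f : N → V →L[𝕜] 𝕜} (hf : ∀ u, ContMDiff I 𝓘(ℝ, 𝕜) ∞ fun p => f p u) :
    ContMDiff I 𝓘(ℝ, V →L[𝕜] 𝕜) ∞ f := by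
  intro p
  have h1 : ContDiffOn ℝ ∞ (f ∘ (extChartAt I p).symm) (extChartAt I p).target := by
    refine contDiffOn_of_pointwise (isOpen_extChartAt_target p) fun u => ?_
    exact ((hf u).comp_contMDiffOn (contMDiffOn_extChartAt_symm p)).contDiffOn
  have h2 : ContMDiffAt I 𝓘(ℝ, V →L[𝕜] 𝕜) ∞
      ((f ∘ (extChartAt I p).symm) ∘ extChartAt I p) p :=
    (h1.contDiffAt (extChartAt_target_mem_nhds p)).contMDiffAt.comp p contMDiffAt_extChartAt
  refine h2.congr_of_eventuallyEq ?_
  filter_upwards [extChartAt_source_mem_nhds (I := I) p] with q hq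
  exact congrArg f ((extChartAt I p).left_inv hq).symm

end WeakSmoothness

/-- A weakly `C^∞` map from a manifold to a Hilbert space is `C^∞`. -/
theorem contMDiff_of_inner {𝕜 : Type*} [RCLike 𝕜] {V : Type*} [NormedAddCommGroup V]
    [InnerProductSpace 𝕜 V] [NormedSpace ℝ V] [CompleteSpace V]
    {E : Type*} [NormedAddCommGroup E] [NormedSpace ℝ E] [FiniteDimensional ℝ E]
    {H : Type*} [TopologicalSpace H] {I : ModelWithCorners ℝ E H}
    [I.Boundaryless] {N : Type*} [TopologicalSpace N] [ChartedSpace H N] [IsManifold I ∞ N]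
    {f : N → V} (hf : ∀ u, ContMDiff I 𝓘(ℝ, 𝕜) ∞ fun p => inner 𝕜 (f p) u) :
    ContMDiff I 𝓘(ℝ, V) ∞ f := by
  have h1 : ContMDiff I 𝓘(ℝ, V →L[𝕜] 𝕜) ∞ fun p => innerSL 𝕜 (f p) :=
    contMDiff_of_pointwise fun u => by simpa using hf u
  -- The Riesz isomorphism is conjugate-linear over `𝕜`, so its inverse is used only as a continuous
  -- real-linear map.
  let j : (V →L[𝕜] 𝕜) →L[ℝ] V :=
    AddMonoidHom.toRealLinearMap ((InnerProductSpace.toDual 𝕜 V).symm : (V →L[𝕜] 𝕜) →+ V)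
      (InnerProductSpace.toDual 𝕜 V).symm.continuous
  have h2 := j.contMDiff.comp h1 (n := ∞)
  refine h2.congr fun p => ?_
  exact ((InnerProductSpace.toDual 𝕜 V).symm_apply_apply (f p)).symm

/-! ### Covariant derivatives of vector-valued functions in coordinates -/

section CovTensor

variable {F : Type*} [NormedAddCommGroup F] [NormedSpace ℝ F]
  {E : Type*} [NormedAddCommGroup E] [NormedSpace ℝ E]

/-- The `k`-th covariant derivative of a function with values in a normed space. -/
def covTensor (G : F → F →L[ℝ] F →L[ℝ] ℝ) (f : F → E) : (k : ℕ) → F → (Fin k → F) → E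
  | 0, y, _ => f y
  | k + 1, y, w =>
      fderiv ℝ (fun z => covTensor G f k z (Fin.tail w)) y (w 0) -
        ∑ i : Fin k, covTensor G f k y
          (Function.update (Fin.tail w) i (christoffel G y (w 0) (Fin.tail w i)))

/-- Scalar functions are a special case; general values allow differentiating one universal
vector-valued map and applying a functional afterwards. -/
theorem iteratedCovDeriv_eq_covTensor {𝕜 : Type*} [RCLike 𝕜] (G : F → F →L[ℝ] F →L[ℝ] ℝ)
    (f : F → 𝕜) (k : ℕ) : iteratedCovDeriv G f k = covTensor G f k := by
  induction k with
  | zero => rfl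
  | succ k ih =>
    funext y w
    simp only [iteratedCovDeriv, covTensor, ih]

/-- `G` is a smooth Riemannian metric on the subset `O` of the vector space `F`. -/
structure IsSmoothMetricOn (G : F → F →L[ℝ] F →L[ℝ] ℝ) (O : Set F) : Prop where
  contDiffOn : ContDiffOn ℝ ∞ G O
  symm : ∀ y ∈ O, ∀ u w, G y u w = G y w u
  pos : ∀ y ∈ O, ∀ u, u ≠ 0 → 0 < G y u u

variable {G G' : F → F →L[ℝ] F →L[ℝ] ℝ} {O O' : Set F}

theorem IsSmoothMetricOn.mono (hG : IsSmoothMetricOn G O) (h : O' ⊆ O) :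
    IsSmoothMetricOn G O' :=
  ⟨hG.contDiffOn.mono h, fun y hy => hG.symm y (h hy), fun y hy => hG.pos y (h hy)⟩

theorem IsSmoothMetricOn.eq_of_forall (hG : IsSmoothMetricOn G O) {y : F} (hy : y ∈ O) {a b : F}
    (h : ∀ z, G y a z = G y b z) : a = b := by
  by_contra hab
  have h1 := hG.pos y hy (a - b) (sub_ne_zero.2 hab)
  have h2 := h (a - b)
  simp only [map_sub, sub_apply] at h1 h2
  linarith

/-- No condition on `G` is needed here or in the three lemmas below: `ContinuousLinearMap.inverse`
yields a linear map even when `G y` is not invertible. -/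
theorem christoffel_add_left (y u u' w : F) :
    christoffel G y (u + u') w = christoffel G y u w + christoffel G y u' w := by
  simp only [christoffel, ← map_add, ← smul_add]
  congr 2
  ext z
  simp
  ring

theorem christoffel_add_right (y u w w' : F) :
    christoffel G y u (w + w') = christoffel G y u w + christoffel G y u w' := by
  simp only [christoffel, ← map_add, ← smul_add]
  congr 2
  ext z
  simp
  ring

theorem christoffel_smul_left (y w u : F) (c : ℝ) :
    christoffel G y (c • u) w = c • christoffel G y u w := by
  simp only [christoffel, ← map_smul]
  congr 1
  ext z
  simp
  ring

theorem christoffel_smul_right (y w u : F) (c : ℝ) :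
    christoffel G y u (c • w) = c • christoffel G y u w := by
  simp only [christoffel, ← map_smul]
  congr 1
  ext z
  simp
  ring

variable [FiniteDimensional ℝ F]

theorem IsSmoothMetricOn.isInvertible (hG : IsSmoothMetricOn G O) {y : F} (hy : y ∈ O) :
    (G y).IsInvertible := by
  have hinj : Function.Injective (G y : F →ₗ[ℝ] F →L[ℝ] ℝ) := fun a b hab =>
    hG.eq_of_forall hy fun z => by
      have : G y a = G y b := hab
      rw [this]
  have hdim : Module.finrank ℝ F = Module.finrank ℝ (F →L[ℝ] ℝ) := by
    rw [← (LinearMap.toContinuousLinearMap (𝕜 := ℝ) (E := F) (F' := ℝ)).finrank_eq]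
    exact (Subspace.dual_finrank_eq (K := ℝ) (V := F)).symm
  exact ⟨(LinearEquiv.ofInjectiveOfFinrankEq (G y : F →ₗ[ℝ] F →L[ℝ] ℝ) hinj
    hdim).toContinuousLinearEquiv, by ext; rfl⟩

/-- The defining identity of the Christoffel symbols. -/
theorem IsSmoothMetricOn.two_mul_christoffel (hG : IsSmoothMetricOn G O) {y : F} (hy : y ∈ O)
    (u w z : F) : 2 * G y (christoffel G y u w) z =
      fderiv ℝ G y u w z + fderiv ℝ G y w u z - fderiv ℝ G y z u w := by
  rw [christoffel, (hG.isInvertible hy).self_apply_inverse]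
  simp

/-- Operator inversion is smooth at invertible operators. The point and both vectors may depend on a
parameter, as needed in the induction for covariant derivatives. -/
theorem IsSmoothMetricOn.contDiffOn_christoffel (hG : IsSmoothMetricOn G O) (hO : IsOpen O)
    {X : Type*} [NormedAddCommGroup X] [NormedSpace ℝ X] {s : Set X} {y u w : X → F}
    (hy : ContDiffOn ℝ ∞ y s) (hu : ContDiffOn ℝ ∞ u s) (hw : ContDiffOn ℝ ∞ w s)
    (hs : MapsTo y s O) :
    ContDiffOn ℝ ∞ (fun x => christoffel G (y x) (u x) (w x)) s := by
  have h1 : ContDiffOn ℝ ∞ (fun x => (G (y x)).inverse) s := fun x hx =>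
    ContDiffAt.comp_contDiffWithinAt (f := fun x => G (y x)) x
      (hG.isInvertible (hs hx)).contDiffAt_map_inverse ((hG.contDiffOn.comp hy hs) x hx)
  have h2 : ContDiffOn ℝ ∞ (fun x => fderiv ℝ G (y x)) s :=
    (hG.contDiffOn.fderiv_of_isOpen hO (by simp)).comp hy hs
  have h3 : ContDiffOn ℝ ∞ (fun x => (fderiv ℝ G (y x)).flip) s :=
    (ContinuousLinearMap.flipₗᵢ ℝ F F (F →L[ℝ] ℝ)).toContinuousLinearEquiv.contDiff.comp_contDiffOn
      h2
  have h4 : ContDiffOn ℝ ∞ (fun x => ((fderiv ℝ G (y x)).flip (u x)).flip) s :=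
    (ContinuousLinearMap.flipₗᵢ ℝ F F ℝ).toContinuousLinearEquiv.contDiff.comp_contDiffOn
      (h3.clm_apply hu)
  exact h1.clm_apply (ContDiffOn.const_smul (1 / 2 : ℝ)
    ((((h2.clm_apply hu).clm_apply hw).add ((h2.clm_apply hw).clm_apply hu)).sub
      (h4.clm_apply hw)))

variable {f : F → E}

/-- The covariant derivative is jointly smooth in the base point and the vectors. -/
theorem IsSmoothMetricOn.contDiffOn_covTensor (hG : IsSmoothMetricOn G O) (hO : IsOpen O)
    (hf : ContDiffOn ℝ ∞ f O) (k : ℕ) :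
    ContDiffOn ℝ ∞ (fun p : F × (Fin k → F) => covTensor G f k p.1 p.2) (O ×ˢ univ) := by
  induction k with
  | zero => exact hf.comp contDiffOn_fst fun p hp => hp.1
  | succ k ih =>
    have hop : IsOpen (O ×ˢ (univ : Set (Fin k → F))) := hO.prod isOpen_univ
    have htail : ContDiff ℝ ∞ (fun p : F × (Fin (k + 1) → F) => Fin.tail p.2) :=
      contDiff_pi.2 fun i => (contDiff_apply ℝ F i.succ).comp contDiff_snd
    have hzero : ContDiff ℝ ∞ (fun p : F × (Fin (k + 1) → F) => p.2 0) :=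
      (contDiff_apply ℝ F 0).comp contDiff_snd
    -- The derivative in the base point is the total derivative of the jointly smooth map in the
    -- direction `(p.2 0, 0)`.
    have h1 : ContDiffOn ℝ ∞ (fun p : F × (Fin (k + 1) → F) =>
        fderiv ℝ (fun q : F × (Fin k → F) => covTensor G f k q.1 q.2) (p.1, Fin.tail p.2)
          (p.2 0, 0)) (O ×ˢ univ) := by
      refine ContDiffOn.clm_apply ?_ (hzero.prodMk contDiff_const).contDiffOn
      exact (ih.fderiv_of_isOpen hop (by simp)).comp
        (contDiff_fst.prodMk htail).contDiffOn fun p hp => ⟨hp.1, mem_univ _⟩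
    have h2 : ContDiffOn ℝ ∞ (fun p : F × (Fin (k + 1) → F) =>
        fderiv ℝ (fun z => covTensor G f k z (Fin.tail p.2)) p.1 (p.2 0)) (O ×ˢ univ) := by
      refine h1.congr fun p hp => ?_
      have hd : HasFDerivAt (fun q : F × (Fin k → F) => covTensor G f k q.1 q.2)
          _ (p.1, Fin.tail p.2) :=
        ((ih.contDiffAt (hop.mem_nhds ⟨hp.1, mem_univ _⟩)).differentiableAt
          (by simp)).hasFDerivAt
      have := hd.comp (f := fun z => (z, Fin.tail p.2)) p.1
        ((hasFDerivAt_id p.1).prodMk (hasFDerivAt_const (Fin.tail p.2) p.1))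
      exact congrArg (fun L : F →L[ℝ] E => L (p.2 0)) this.fderiv
    refine h2.sub (ContDiffOn.sum fun i _ => ?_)
    have hupd : ContDiffOn ℝ ∞ (fun p : F × (Fin (k + 1) → F) => Function.update (Fin.tail p.2) i
        (christoffel G p.1 (p.2 0) (Fin.tail p.2 i))) (O ×ˢ univ) := by
      refine contDiffOn_pi.2 fun j => ?_
      by_cases hij : j = i
      · subst hij
        simp only [Function.update_self]
        exact hG.contDiffOn_christoffel hO contDiffOn_fst hzero.contDiffOn
          ((contDiff_apply ℝ F j).comp htail).contDiffOn fun p hp => hp.1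
      · simp only [Function.update_of_ne hij]
        exact ((contDiff_apply ℝ F j).comp htail).contDiffOn
    exact ih.comp (contDiffOn_fst.prodMk hupd) fun p hp => ⟨hp.1, mem_univ _⟩

theorem IsSmoothMetricOn.differentiableAt_covTensor (hG : IsSmoothMetricOn G O) (hO : IsOpen O)
    (hf : ContDiffOn ℝ ∞ f O) {k : ℕ} {y : F} (hy : y ∈ O) (w : Fin k → F) :
    DifferentiableAt ℝ (fun p : F × (Fin k → F) => covTensor G f k p.1 p.2) (y, w) :=
  ((hG.contDiffOn_covTensor hO hf k).contDiffAt
    ((hO.prod isOpen_univ).mem_nhds ⟨hy, mem_univ _⟩)).differentiableAt (by simp)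

theorem IsSmoothMetricOn.differentiableAt_covTensor_left (hG : IsSmoothMetricOn G O)
    (hO : IsOpen O) (hf : ContDiffOn ℝ ∞ f O) {k : ℕ} {y : F} (hy : y ∈ O) (w : Fin k → F) :
    DifferentiableAt ℝ (fun z => covTensor G f k z w) y :=
  (hG.differentiableAt_covTensor hO hf hy w).comp (f := fun z => (z, w)) y
    (differentiableAt_id.prodMk (differentiableAt_const w))

/-- Together with `covTensor_update_smul` this is multilinearity. Slot `0` enters only through a
derivative direction and the first argument of the Christoffel symbol; the other slots are handled
by induction. -/
theorem IsSmoothMetricOn.covTensor_update_add (hG : IsSmoothMetricOn G O) (hO : IsOpen O)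
    (hf : ContDiffOn ℝ ∞ f O) {k : ℕ} {y : F} (hy : y ∈ O) (w : Fin k → F) (i : Fin k) (a b : F) :
    covTensor G f k y (Function.update w i (a + b)) =
      covTensor G f k y (Function.update w i a) + covTensor G f k y (Function.update w i b) := by
  induction k generalizing y a b with
  | zero => exact i.elim0
  | succ k ih =>
    refine Fin.cases ?_ (fun j => ?_) i
    · simp only [covTensor, Fin.tail_update_zero, Function.update_self, map_add,
        christoffel_add_left, ih hy, Finset.sum_add_distrib]
      abel
    · have hne : (0 : Fin (k + 1)) ≠ j.succ := (Fin.succ_ne_zero j).symm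
      simp only [covTensor, Fin.tail_update_succ, Function.update_of_ne hne]
      have h1 : fderiv ℝ (fun z => covTensor G f k z (Function.update (Fin.tail w) j (a + b))) y =
          fderiv ℝ (fun z => covTensor G f k z (Function.update (Fin.tail w) j a)) y +
          fderiv ℝ (fun z => covTensor G f k z (Function.update (Fin.tail w) j b)) y := by
        rw [← fderiv_add (hG.differentiableAt_covTensor_left hO hf hy _)
          (hG.differentiableAt_covTensor_left hO hf hy _)]
        refine Filter.EventuallyEq.fderiv_eq ?_
        filter_upwards [hO.mem_nhds hy] with z hz using ih hz _ _ _ _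
      -- For `l = j` the slot holds a Christoffel symbol, additive in its second argument; for `l ≠
      -- j` the two updates commute.
      have h2 : ∀ l : Fin k, covTensor G f k y (Function.update
            (Function.update (Fin.tail w) j (a + b)) l
            (christoffel G y (w 0) (Function.update (Fin.tail w) j (a + b) l))) =
          covTensor G f k y (Function.update (Function.update (Fin.tail w) j a) l
            (christoffel G y (w 0) (Function.update (Fin.tail w) j a l))) +
          covTensor G f k y (Function.update (Function.update (Fin.tail w) j b) l
            (christoffel G y (w 0) (Function.update (Fin.tail w) j b l))) := by
        intro l
        by_cases hl : l = j
        · subst hl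
          simp only [Function.update_self, Function.update_idem, christoffel_add_right, ih hy]
        · simp only [Function.update_of_ne hl, Function.update_comm (Ne.symm hl), ih hy]
      rw [h1, Finset.sum_congr rfl fun l _ => h2 l, Finset.sum_add_distrib, add_apply]
      abel

theorem IsSmoothMetricOn.covTensor_update_smul (hG : IsSmoothMetricOn G O) (hO : IsOpen O)
    (hf : ContDiffOn ℝ ∞ f O) {k : ℕ} {y : F} (hy : y ∈ O) (w : Fin k → F) (i : Fin k) (c : ℝ)
    (a : F) : covTensor G f k y (Function.update w i (c • a)) =
      c • covTensor G f k y (Function.update w i a) := by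
  induction k generalizing y a with
  | zero => exact i.elim0
  | succ k ih =>
    refine Fin.cases ?_ (fun j => ?_) i
    · simp only [covTensor, Fin.tail_update_zero, Function.update_self, map_smul,
        christoffel_smul_left, ih hy, smul_sub, Finset.smul_sum]
    · have hne : (0 : Fin (k + 1)) ≠ j.succ := (Fin.succ_ne_zero j).symm
      simp only [covTensor, Fin.tail_update_succ, Function.update_of_ne hne]
      have h1 : fderiv ℝ (fun z => covTensor G f k z (Function.update (Fin.tail w) j (c • a))) y =
          c • fderiv ℝ (fun z => covTensor G f k z (Function.update (Fin.tail w) j a)) y := by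
        rw [← fderiv_const_smul (hG.differentiableAt_covTensor_left hO hf hy _)]
        refine Filter.EventuallyEq.fderiv_eq ?_
        filter_upwards [hO.mem_nhds hy] with z hz using ih hz _ _ _
      have h2 : ∀ l : Fin k, covTensor G f k y (Function.update
            (Function.update (Fin.tail w) j (c • a)) l
            (christoffel G y (w 0) (Function.update (Fin.tail w) j (c • a) l))) =
          c • covTensor G f k y (Function.update (Function.update (Fin.tail w) j a) l
            (christoffel G y (w 0) (Function.update (Fin.tail w) j a l))) := by
        intro l
        by_cases hl : l = j
        · subst hl
          simp only [Function.update_self, Function.update_idem, christoffel_smul_right, ih hy]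
        · simp only [Function.update_of_ne hl, Function.update_comm (Ne.symm hl), ih hy]
      rw [h1, Finset.sum_congr rfl fun l _ => h2 l, smul_apply, smul_sub, Finset.smul_sum]

/-- Covariant differentiation commutes with continuous linear maps. -/
theorem IsSmoothMetricOn.covTensor_clm_comp (hG : IsSmoothMetricOn G O) (hO : IsOpen O)
    (hf : ContDiffOn ℝ ∞ f O) {E' : Type*} [NormedAddCommGroup E'] [NormedSpace ℝ E']
    (L : E →L[ℝ] E') {k : ℕ} {y : F} (hy : y ∈ O) (w : Fin k → F) :
    covTensor G (fun z => L (f z)) k y w = L (covTensor G f k y w) := by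
  induction k generalizing y with
  | zero => rfl
  | succ k ih =>
    have h1 : fderiv ℝ (fun z => covTensor G (fun z => L (f z)) k z (Fin.tail w)) y =
        L ∘L fderiv ℝ (fun z => covTensor G f k z (Fin.tail w)) y := by
      rw [← (L.hasFDerivAt.comp y
        (hG.differentiableAt_covTensor_left hO hf hy (Fin.tail w)).hasFDerivAt).fderiv]
      refine Filter.EventuallyEq.fderiv_eq ?_
      filter_upwards [hO.mem_nhds hy] with z hz using ih hz _
    simp only [covTensor, h1, ih hy, map_sub, map_sum, ContinuousLinearMap.comp_apply]

/-- The total derivative of the covariant derivative, in terms of the derivative in the base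
point. -/
theorem IsSmoothMetricOn.fderiv_covTensor_apply (hG : IsSmoothMetricOn G O) (hO : IsOpen O)
    (hf : ContDiffOn ℝ ∞ f O) {k : ℕ} {y : F} (hy : y ∈ O) (w : Fin k → F) (h : F)
    (v : Fin k → F) :
    fderiv ℝ (fun p : F × (Fin k → F) => covTensor G f k p.1 p.2) (y, w) (h, v) =
      fderiv ℝ (fun z => covTensor G f k z w) y h +
        ∑ i, covTensor G f k y (Function.update w i (v i)) := by
  have hd := (hG.differentiableAt_covTensor hO hf hy w).hasFDerivAt
  set L := fderiv ℝ (fun p : F × (Fin k → F) => covTensor G f k p.1 p.2) (y, w) with hL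
  have h1 : fderiv ℝ (fun z => covTensor G f k z w) y h = L (h, 0) := by
    have := hd.comp (f := fun z => (z, w)) y ((hasFDerivAt_id y).prodMk (hasFDerivAt_const w y))
    exact congrArg (fun L : F →L[ℝ] E => L h) this.fderiv
  -- By multilinearity the tensor is affine along a line that moves only the `i`-th vector, so its
  -- derivative there is its slope.
  have h2 : ∀ i, covTensor G f k y (Function.update w i (v i)) = L (0, Pi.single i (v i)) := by
    intro i
    have hline : HasDerivAt (fun t : ℝ => ((y, w) : F × (Fin k → F)) + t • (0, Pi.single i (v i)))
        (0, Pi.single i (v i)) 0 := by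
      simpa using ((hasDerivAt_id (0 : ℝ)).smul_const
        ((0, Pi.single i (v i)) : F × (Fin k → F))).const_add (y, w)
    have hd' : HasFDerivAt (fun p : F × (Fin k → F) => covTensor G f k p.1 p.2) L
        (((y, w) : F × (Fin k → F)) + (0 : ℝ) • (0, Pi.single i (v i))) := by simpa using hd
    have ha := hd'.comp_hasDerivAt (0 : ℝ) hline
    have heq : ((fun p : F × (Fin k → F) => covTensor G f k p.1 p.2) ∘
        fun t : ℝ => ((y, w) : F × (Fin k → F)) + t • (0, Pi.single i (v i))) =
        fun t => covTensor G f k y w + t • covTensor G f k y (Function.update w i (v i)) := by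
      funext t
      have : w + t • (Pi.single i (v i) : Fin k → F) = Function.update w i (w i + t • v i) := by
        funext j
        by_cases hj : j = i
        · subst hj; simp
        · simp [hj]
      simp only [Function.comp_apply, Prod.smul_mk, Prod.mk_add_mk, smul_zero, add_zero, this]
      rw [hG.covTensor_update_add hO hf hy, hG.covTensor_update_smul hO hf hy,
        Function.update_eq_self]
    rw [heq] at ha
    have hb : HasDerivAt (fun t : ℝ => covTensor G f k y w +
        t • covTensor G f k y (Function.update w i (v i)))
        (covTensor G f k y (Function.update w i (v i))) 0 := by
      simpa using ((hasDerivAt_id (0 : ℝ)).smul_const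
        (covTensor G f k y (Function.update w i (v i)))).const_add (covTensor G f k y w)
    exact hb.unique ha
  rw [h1, Finset.sum_congr rfl fun i _ => h2 i, ← map_sum, ← map_add]
  congr 1
  ext1
  · simp [Prod.fst_sum]
  · simp [Prod.snd_sum, Finset.univ_sum_single]

end CovTensor

/-! ### Change of coordinates -/

section ChangeOfCoordinates

variable {F : Type*} [NormedAddCommGroup F] [NormedSpace ℝ F] [FiniteDimensional ℝ F]
  {E : Type*} [NormedAddCommGroup E] [NormedSpace ℝ E]
  {G G' : F → F →L[ℝ] F →L[ℝ] ℝ} {O O' : Set F} {τ : F → F}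

/-- The transformation law of the Christoffel symbols. -/
theorem IsSmoothMetricOn.fderiv_christoffel (hG : IsSmoothMetricOn G O) (hO : IsOpen O)
    (hG' : IsSmoothMetricOn G' O') (hO' : IsOpen O') (hτ : ContDiffOn ℝ ∞ τ O')
    (hmaps : MapsTo τ O' O)
    (hpull : ∀ z ∈ O', ∀ u w, G' z u w = G (τ z) (fderiv ℝ τ z u) (fderiv ℝ τ z w))
    {y : F} (hy : y ∈ O') (u w : F) :
    fderiv ℝ τ y (christoffel G' y u w) =
      christoffel G (τ y) (fderiv ℝ τ y u) (fderiv ℝ τ y w) +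
        fderiv ℝ (fderiv ℝ τ) y u w := by
  have hτy : τ y ∈ O := hmaps hy
  have hcτ : ContDiffAt ℝ ∞ τ y := hτ.contDiffAt (hO'.mem_nhds hy)
  have hdτ : HasFDerivAt τ (fderiv ℝ τ y) y := (hcτ.differentiableAt (by simp)).hasFDerivAt
  have hddτ : HasFDerivAt (fderiv ℝ τ) (fderiv ℝ (fderiv ℝ τ) y) y :=
    ((hcτ.fderiv_right (m := 1) (by norm_cast)).differentiableAt
      (by simp)).hasFDerivAt
  have hsymm : ∀ a b, fderiv ℝ (fderiv ℝ τ) y a b = fderiv ℝ (fderiv ℝ τ) y b a := fun a b =>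
    (hcτ.isSymmSndFDerivAt (by simp; norm_cast)).eq a b
  have hdG : HasFDerivAt G (fderiv ℝ G (τ y)) (τ y) :=
    ((hG.contDiffOn.contDiffAt (hO.mem_nhds hτy)).differentiableAt (by simp)).hasFDerivAt
  have hdG' : HasFDerivAt G' (fderiv ℝ G' y) y :=
    ((hG'.contDiffOn.contDiffAt (hO'.mem_nhds hy)).differentiableAt (by simp)).hasFDerivAt
  set A := fderiv ℝ τ y with hA
  set β := fderiv ℝ (fderiv ℝ τ) y
  -- `τ` is not assumed to be a diffeomorphism: a positive definite pullback already forces its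
  -- derivative to be injective, hence bijective.
  have hinj : Function.Injective (A : F →ₗ[ℝ] F) := by
    rw [← LinearMap.ker_eq_bot, LinearMap.ker_eq_bot']
    intro v hv
    by_contra hne
    have h1 := hG'.pos y hy v hne
    have hv' : A v = 0 := hv
    rw [hpull y hy, ← hA, hv'] at h1
    simp at h1
  have hsurj : Function.Surjective (A : F →ₗ[ℝ] F) := LinearMap.injective_iff_surjective.1 hinj
  have hD : ∀ h a b, fderiv ℝ G' y h a b =
      fderiv ℝ G (τ y) (A h) (A a) (A b) + G (τ y) (β h a) (A b) + G (τ y) (A a) (β h b) := by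
    intro h a b
    have h1 : HasFDerivAt (fun z => G' z a b) _ y :=
      (hdG'.clm_apply (hasFDerivAt_const a y)).clm_apply (hasFDerivAt_const b y)
    have h2 : HasFDerivAt (fun z => G (τ z) (fderiv ℝ τ z a) (fderiv ℝ τ z b)) _ y :=
      ((hdG.comp y hdτ).clm_apply (hddτ.clm_apply (hasFDerivAt_const a y))).clm_apply
        (hddτ.clm_apply (hasFDerivAt_const b y))
    have heq : (fun z => G' z a b) =ᶠ[𝓝 y]
        fun z => G (τ z) (fderiv ℝ τ z a) (fderiv ℝ τ z b) := by
      filter_upwards [hO'.mem_nhds hy] with z hz using hpull z hz a b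
    have h3 := congrArg (fun L : F →L[ℝ] ℝ => L h) ((h2.congr_of_eventuallyEq heq).unique h1)
    simp [← hA] at h3
    linarith
  -- Every test vector has the form `A z`. In the Koszul combination the second-derivative terms
  -- cancel, by symmetry of `β` and of `G`, except `2 G(β u w, A z)`.
  refine hG.eq_of_forall hτy fun z => ?_
  obtain ⟨z, rfl⟩ := hsurj z
  have e1 := hG'.two_mul_christoffel hy u w z
  have e2 := hG.two_mul_christoffel hτy (A u) (A w) (A z)
  rw [hpull y hy, ← hA] at e1
  simp only [hD] at e1
  have s1 := hsymm u w
  have s2 := hsymm u z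
  have s3 := hsymm w z
  rw [s2, s3, ← s1, hG.symm _ hτy (A w) (β z u)] at e1
  change G (τ y) _ (A z) = G (τ y) _ (A z)
  rw [map_add, add_apply]
  linarith

/-- Covariant derivatives are natural with respect to changes of coordinates. -/
theorem IsSmoothMetricOn.covTensor_comp (hG : IsSmoothMetricOn G O) (hO : IsOpen O)
    (hG' : IsSmoothMetricOn G' O') (hO' : IsOpen O') (hτ : ContDiffOn ℝ ∞ τ O')
    (hmaps : MapsTo τ O' O)
    (hpull : ∀ z ∈ O', ∀ u w, G' z u w = G (τ z) (fderiv ℝ τ z u) (fderiv ℝ τ z w))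
    {f f' : F → E} (hf : ContDiffOn ℝ ∞ f O) (hff' : ∀ z ∈ O', f' z = f (τ z))
    {k : ℕ} {y : F} (hy : y ∈ O') (w : Fin k → F) :
    covTensor G' f' k y w = covTensor G f k (τ y) (fun i => fderiv ℝ τ y (w i)) := by
  induction k generalizing y with
  | zero => exact hff' y hy
  | succ k ih =>
    have hτy : τ y ∈ O := hmaps hy
    have hcτ : ContDiffAt ℝ ∞ τ y := hτ.contDiffAt (hO'.mem_nhds hy)
    have hdτ : HasFDerivAt τ (fderiv ℝ τ y) y := (hcτ.differentiableAt (by simp)).hasFDerivAt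
    have hddτ : HasFDerivAt (fderiv ℝ τ) (fderiv ℝ (fderiv ℝ τ) y) y :=
      ((hcτ.fderiv_right (m := 1) (by norm_cast)).differentiableAt
        (by simp)).hasFDerivAt
    have h1 : fderiv ℝ (fun z => covTensor G' f' k z (Fin.tail w)) y (w 0) =
        fderiv ℝ (fun p : F × (Fin k → F) => covTensor G f k p.1 p.2)
          (τ y, fun i => fderiv ℝ τ y (Fin.tail w i))
          (fderiv ℝ τ y (w 0), fun i => fderiv ℝ (fderiv ℝ τ) y (w 0) (Fin.tail w i)) := by
      have hin : HasFDerivAt (fun z => (τ z, fun i : Fin k => fderiv ℝ τ z (Fin.tail w i)))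
          ((fderiv ℝ τ y).prod
            (ContinuousLinearMap.pi fun i : Fin k =>
              (fderiv ℝ (fderiv ℝ τ) y).flip (Fin.tail w i))) y := by
        refine hdτ.prodMk (hasFDerivAt_pi.2 fun i => ?_)
        have := hddτ.clm_apply (hasFDerivAt_const (Fin.tail w i) y)
        simpa using this
      have hout := (hG.differentiableAt_covTensor hO hf hτy
        (fun i => fderiv ℝ τ y (Fin.tail w i))).hasFDerivAt
      have hc := HasFDerivAt.comp (f := fun z => (τ z, fun i : Fin k => fderiv ℝ τ z (Fin.tail w i)))
        y hout hin
      have heq : (fun z => covTensor G' f' k z (Fin.tail w)) =ᶠ[𝓝 y]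
          (fun p : F × (Fin k → F) => covTensor G f k p.1 p.2) ∘
            fun z => (τ z, fun i : Fin k => fderiv ℝ τ z (Fin.tail w i)) := by
        filter_upwards [hO'.mem_nhds hy] with z hz using ih hz _
      rw [(hc.congr_of_eventuallyEq heq).fderiv]
      rfl
    -- The transformation law splits slot `i` in two. The second-derivative part cancels the term
    -- that the chain rule in `h1` produces by differentiating `Dτ (w i)`.
    have h2 : ∀ i : Fin k, covTensor G' f' k y
          (Function.update (Fin.tail w) i (christoffel G' y (w 0) (Fin.tail w i))) =
        covTensor G f k (τ y) (Function.update (fun i => fderiv ℝ τ y (Fin.tail w i)) i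
          (christoffel G (τ y) (fderiv ℝ τ y (w 0)) (fderiv ℝ τ y (Fin.tail w i)))) +
        covTensor G f k (τ y) (Function.update (fun i => fderiv ℝ τ y (Fin.tail w i)) i
          (fderiv ℝ (fderiv ℝ τ) y (w 0) (Fin.tail w i))) := by
      intro i
      rw [ih hy, ← hG.covTensor_update_add hO hf hτy,
        ← hG.fderiv_christoffel hO hG' hO' hτ hmaps hpull hy]
      congr 1
      funext j
      by_cases hj : j = i
      · subst hj; simp
      · simp [hj]
    simp only [covTensor]
    rw [h1, hG.fderiv_covTensor_apply hO hf hτy, Finset.sum_congr rfl fun i _ => h2 i,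
      Finset.sum_add_distrib]
    simp only [Fin.tail]
    abel

end ChangeOfCoordinates

/-! ### Bounds for covariant derivatives on compact sets -/

section CompactBounds

variable {F : Type*} [NormedAddCommGroup F] [NormedSpace ℝ F]

/-- On compact sets a smooth metric is uniformly positive definite. -/
theorem IsSmoothMetricOn.exists_pos_mul_sq_le [FiniteDimensional ℝ F]
    {G : F → F →L[ℝ] F →L[ℝ] ℝ} {O s : Set F}
    (hG : IsSmoothMetricOn G O) (hs : IsCompact s) (hsO : s ⊆ O) :
    ∃ c > 0, ∀ y ∈ s, ∀ u, c * ‖u‖ ^ 2 ≤ G y u u := by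
  have hcont : ContinuousOn (fun p : F × F => G p.1 p.2 p.2) (s ×ˢ Metric.sphere (0 : F) 1) := by
    have h1 : ContinuousOn (fun p : F × F => G p.1) (s ×ˢ Metric.sphere (0 : F) 1) :=
      hG.contDiffOn.continuousOn.comp continuousOn_fst fun p hp => hsO hp.1
    exact (h1.clm_apply continuousOn_snd).clm_apply continuousOn_snd
  -- This form of the extreme value theorem also gives a positive `c` when the unit sphere is empty,
  -- that is, in dimension zero.
  obtain ⟨c, hc, hle⟩ := (hs.prod (isCompact_sphere (0 : F) 1)).exists_forall_le' hcont
    (a := 0) fun p hp => hG.pos p.1 (hsO hp.1) p.2 (by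
      rintro h0
      have := hp.2
      simp [h0] at this)
  refine ⟨c, hc, fun y hy u => ?_⟩
  by_cases hu : u = 0
  · simp [hu]
  have hn : ‖u‖ ≠ 0 := norm_ne_zero_iff.2 hu
  have h1 := hle (y, ‖u‖⁻¹ • u) ⟨hy, by simp [norm_smul, hn]⟩
  simp only [map_smul, smul_apply, smul_eq_mul] at h1
  calc c * ‖u‖ ^ 2 ≤ (‖u‖⁻¹ * (‖u‖⁻¹ * G y u u)) * ‖u‖ ^ 2 := by gcongr
    _ = G y u u := by field_simp

variable {H : Type*} [TopologicalSpace H] {I : ModelWithCorners ℝ F H}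
  {N : Type*} [TopologicalSpace N] [ChartedSpace H N]

/-- A field of bilinear forms, with the tangent spaces replaced by the model space. -/
def modelForm (B : ∀ q : N, TangentSpace I q →L[ℝ] TangentSpace I q →L[ℝ] ℝ) (q : N) :
    F →L[ℝ] F →L[ℝ] ℝ :=
  B q

/-- The derivative of the inverse of the preferred chart at `p`. -/
def chartSymmDeriv (I : ModelWithCorners ℝ F H) (p : N) (y : F) : F →L[ℝ] F :=
  mfderiv 𝓘(ℝ, F) I (extChartAt I p).symm y

theorem chartMetric_apply (B : ∀ q : N, TangentSpace I q →L[ℝ] TangentSpace I q →L[ℝ] ℝ) (p : N)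
    (y u w : F) : chartMetric I B p y u w =
      modelForm B ((extChartAt I p).symm y) (chartSymmDeriv I p y u) (chartSymmDeriv I p y w) :=
  rfl

/-- The domain of a coordinate change. -/
def coordChangeDomain (I : ModelWithCorners ℝ F H) (p q : N) : Set F :=
  (extChartAt I p).target ∩ (extChartAt I p).symm ⁻¹' (extChartAt I q).source

theorem contDiffOn_coordChange [IsManifold I ∞ N] (p q : N) :
    ContDiffOn ℝ ∞ (extChartAt I q ∘ (extChartAt I p).symm) (coordChangeDomain I p q) :=
  (contDiffOn_ext_coord_change q p).mono fun _ hz => hz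

variable [I.Boundaryless]

theorem isOpen_coordChangeDomain (p q : N) : IsOpen (coordChangeDomain I p q) :=
  (continuousOn_extChartAt_symm p).isOpen_inter_preimage (isOpen_extChartAt_target p)
    (isOpen_extChartAt_source q)

variable [IsManifold I ∞ N]

theorem mdifferentiableAt_extChartAt_symm (p : N) {z : F} (hz : z ∈ (extChartAt I p).target) :
    MDifferentiableAt 𝓘(ℝ, F) I (extChartAt I p).symm z :=
  ((contMDiffOn_extChartAt_symm (n := ∞) p).contMDiffAt
    ((isOpen_extChartAt_target p).mem_nhds hz)).mdifferentiableAt (by simp)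

/-- The coordinate expressions of a field of bilinear forms are related by coordinate changes. -/
theorem chartMetric_coordChange
    (B : ∀ q : N, TangentSpace I q →L[ℝ] TangentSpace I q →L[ℝ] ℝ) (p q : N) {z : F}
    (hz : z ∈ coordChangeDomain I p q) (u w : F) :
    chartMetric I B p z u w = chartMetric I B q ((extChartAt I q ∘ (extChartAt I p).symm) z)
      (fderiv ℝ (extChartAt I q ∘ (extChartAt I p).symm) z u)
      (fderiv ℝ (extChartAt I q ∘ (extChartAt I p).symm) z w) := by
  have hinv : ∀ z ∈ coordChangeDomain I p q,
      (extChartAt I q).symm ((extChartAt I q ∘ (extChartAt I p).symm) z) =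
        (extChartAt I p).symm z := fun z hz => (extChartAt I q).left_inv hz.2
  have hτ : DifferentiableAt ℝ (extChartAt I q ∘ (extChartAt I p).symm) z :=
    ((contDiffOn_coordChange p q).contDiffAt
      ((isOpen_coordChangeDomain p q).mem_nhds hz)).differentiableAt (by simp)
  have htgt : (extChartAt I q ∘ (extChartAt I p).symm) z ∈ (extChartAt I q).target :=
    (extChartAt I q).map_source hz.2
  have hcomp := mfderiv_comp (I := 𝓘(ℝ, F)) (I' := 𝓘(ℝ, F)) (I'' := I) z
    (mdifferentiableAt_extChartAt_symm q htgt) hτ.mdifferentiableAt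
  have heq : (extChartAt I q).symm ∘ (extChartAt I q ∘ (extChartAt I p).symm) =ᶠ[𝓝 z]
      (extChartAt I p).symm := by
    filter_upwards [(isOpen_coordChangeDomain p q).mem_nhds hz] with x hx using hinv x hx
  rw [heq.mfderiv_eq, mfderiv_eq_fderiv] at hcomp
  have key : chartSymmDeriv I p z =
      chartSymmDeriv I q ((extChartAt I q ∘ (extChartAt I p).symm) z) ∘L
        fderiv ℝ (extChartAt I q ∘ (extChartAt I p).symm) z := hcomp
  rw [chartMetric_apply, chartMetric_apply, key, hinv z hz]
  rfl

variable [FiniteDimensional ℝ F] {𝕜 : Type*} [RCLike 𝕜]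
  {W : Type*} [NormedAddCommGroup W] [NormedSpace ℝ W]

/-- Near `q`, the covariant derivatives of the functions `L ∘ Φ`, for a smooth vector-valued
function `Φ` and continuous linear functionals `L`, are bounded by `‖L‖`. -/
theorem exists_nhds_covDerivNorm_le
    {B : ∀ q : N, TangentSpace I q →L[ℝ] TangentSpace I q →L[ℝ] ℝ}
    (hB : ∀ p : N, IsSmoothMetricOn (chartMetric I B p) (extChartAt I p).target)
    {Φ : N → W} (hΦ : ContMDiff I 𝓘(ℝ, W) ∞ Φ) (k : ℕ) (q : N) :
    ∃ t ∈ 𝓝 q, ∃ C, 0 ≤ C ∧ ∀ L : W →L[ℝ] 𝕜, ∀ p ∈ t,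
      covDerivNorm I B (fun x => L (Φ x)) k p ≤ ENNReal.ofReal (C * ‖L‖) := by
  set O := (extChartAt I q).target with hO
  have hOo : IsOpen O := isOpen_extChartAt_target q
  set G := chartMetric I B q with hGdef
  have hG : IsSmoothMetricOn G O := hB q
  set f : F → W := Φ ∘ (extChartAt I q).symm with hfdef
  have hf : ContDiffOn ℝ ∞ f O :=
    (hΦ.comp_contMDiffOn (contMDiffOn_extChartAt_symm q)).contDiffOn
  obtain ⟨r, hr, hrO⟩ := Metric.nhds_basis_closedBall.mem_iff.1
    (hOo.mem_nhds (mem_extChartAt_target (I := I) q))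
  set s := Metric.closedBall (extChartAt I q q) r with hs
  have hsc : IsCompact s := isCompact_closedBall _ _
  obtain ⟨c, hc, hcle⟩ := hG.exists_pos_mul_sq_le hsc hrO
  -- A vector of `G`-length one at a point of `s` has model norm at most `ρ`, so `C` bounds the
  -- `k`-th covariant derivative on all such vectors.
  set ρ := Real.sqrt c⁻¹ with hρ
  obtain ⟨C, hC⟩ := (hsc.prod (isCompact_closedBall (0 : Fin k → F) ρ)).exists_bound_of_continuousOn
    ((hG.contDiffOn_covTensor hOo hf k).continuousOn.mono fun p hp => ⟨hrO hp.1, mem_univ _⟩)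
  set n : ℝ := ((Fintype.card (Fin k → Fin (Module.finrank ℝ F)) : ℕ) : ℝ) with hn
  refine ⟨(extChartAt I q).source ∩ extChartAt I q ⁻¹' s, ?_, Real.sqrt n * |C|,
    by positivity, ?_⟩
  · exact inter_mem (extChartAt_source_mem_nhds q)
      ((continuousAt_extChartAt q).preimage_mem_nhds (Metric.closedBall_mem_nhds _ hr))
  intro L p hp
  refine iSup_le fun e => ENNReal.ofReal_le_ofReal ?_
  have hyO : extChartAt I p p ∈ coordChangeDomain I p q :=
    ⟨mem_extChartAt_target p, by
      simpa only [mem_preimage, extChartAt_to_inv] using hp.1⟩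
  set τ := extChartAt I q ∘ (extChartAt I p).symm with hτ
  have hτy : τ (extChartAt I p p) = extChartAt I q p := by
    simp only [hτ, Function.comp_apply, extChartAt_to_inv]
  have hτO : τ (extChartAt I p p) ∈ O := (extChartAt I q).map_source hyO.2
  -- The coordinate change is an isometry of the two coordinate metrics, so it carries the frame `e`
  -- to vectors of `G`-length one.
  have hbound : ∀ a, ‖fderiv ℝ τ (extChartAt I p p) (e.1 a)‖ ≤ ρ := by
    intro a
    have h1 : G (τ (extChartAt I p p)) (fderiv ℝ τ (extChartAt I p p) (e.1 a))
        (fderiv ℝ τ (extChartAt I p p) (e.1 a)) = 1 := by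
      rw [← chartMetric_coordChange B p q hyO, e.2 a a, if_pos rfl]
    have h2 := hcle (τ (extChartAt I p p)) (hτy ▸ hp.2) (fderiv ℝ τ (extChartAt I p p) (e.1 a))
    rw [h1] at h2
    refine Real.le_sqrt_of_sq_le ?_
    rw [← one_div, le_div_iff₀ hc]
    linarith
  have hterm : ∀ i : Fin k → Fin (Module.finrank ℝ F),
      ‖iteratedCovDeriv (chartMetric I B p) ((fun x => L (Φ x)) ∘ (extChartAt I p).symm) k
        (extChartAt I p p) (fun a => e.1 (i a))‖ ≤ |C| * ‖L‖ := by
    intro i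
    -- The tensor is moved from the chart at the varying point `p` to the fixed chart at `q`, and
    -- then `L` is pulled out; what remains does not depend on `L`.
    rw [iteratedCovDeriv_eq_covTensor,
      hG.covTensor_comp hOo ((hB p).mono inter_subset_left) (isOpen_coordChangeDomain p q)
        (contDiffOn_coordChange p q) (fun z hz => (extChartAt I q).map_source hz.2)
        (fun z hz => chartMetric_coordChange B p q hz)
        (f := fun z => L (f z)) (L.contDiff.comp_contDiffOn hf)
        (fun z hz => by
          simp only [hfdef, Function.comp_apply]
          rw [(extChartAt I q).left_inv hz.2]) hyO,
      hG.covTensor_clm_comp hOo hf L hτO]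
    refine (L.le_opNorm _).trans ?_
    rw [mul_comm]
    refine mul_le_mul_of_nonneg_right ((hC
      (τ (extChartAt I p p), fun a => fderiv ℝ τ (extChartAt I p p) (e.1 (i a)))
      ⟨hτy ▸ hp.2, ?_⟩).trans (le_abs_self C)) (norm_nonneg _)
    rw [mem_closedBall_zero_iff, pi_norm_le_iff_of_nonneg (Real.sqrt_nonneg _)]
    exact fun a => hbound (i a)
  calc Real.sqrt (∑ i : Fin k → Fin (Module.finrank ℝ F), ‖iteratedCovDeriv (chartMetric I B p)
        ((fun x => L (Φ x)) ∘ (extChartAt I p).symm) k (extChartAt I p p) (fun a => e.1 (i a))‖ ^ 2)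
      ≤ Real.sqrt (∑ _i : Fin k → Fin (Module.finrank ℝ F), (|C| * ‖L‖) ^ 2) := by
        gcongr with i
        exact hterm i
    _ = Real.sqrt n * |C| * ‖L‖ := by
        rw [Finset.sum_const, nsmul_eq_mul, Finset.card_univ, ← hn,
          Real.sqrt_mul (by positivity), Real.sqrt_sq (by positivity), mul_assoc]

/-- On a compact set, the covariant derivatives of the functions `L ∘ Φ`, for a smooth
vector-valued function `Φ` and continuous linear functionals `L`, are bounded by `‖L‖`. -/
theorem exists_smoothSeminorm_le
    {B : ∀ q : N, TangentSpace I q →L[ℝ] TangentSpace I q →L[ℝ] ℝ}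
    (hB : ∀ p : N, IsSmoothMetricOn (chartMetric I B p) (extChartAt I p).target)
    {Φ : N → W} (hΦ : ContMDiff I 𝓘(ℝ, W) ∞ Φ) (k : ℕ) {U : Set N} (hU : IsCompact U) :
    ∃ C, 0 ≤ C ∧ ∀ L : W →L[ℝ] 𝕜,
      smoothSeminorm I B U k (fun x => L (Φ x)) ≤ ENNReal.ofReal (C * ‖L‖) := by
  simp only [smoothSeminorm, iSup_le_iff]
  refine hU.induction_on (p := fun U => ∃ C, 0 ≤ C ∧ ∀ L : W →L[ℝ] 𝕜, ∀ p ∈ U,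
      covDerivNorm I B (fun x => L (Φ x)) k p ≤ ENNReal.ofReal (C * ‖L‖))
    ⟨0, le_rfl, by simp⟩ ?_ ?_ ?_
  · rintro s t hst ⟨C, hC, h⟩
    exact ⟨C, hC, fun L p hp => h L p (hst hp)⟩
  · rintro s t ⟨C, hC, h⟩ ⟨C', hC', h'⟩
    refine ⟨max C C', le_max_of_le_left hC, ?_⟩
    rintro L p (hp | hp)
    · exact (h L p hp).trans (ENNReal.ofReal_le_ofReal (by gcongr; exact le_max_left _ _))
    · exact (h' L p hp).trans (ENNReal.ofReal_le_ofReal (by gcongr; exact le_max_right _ _))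
  · intro q _
    obtain ⟨t, ht, h⟩ := exists_nhds_covDerivNorm_le (𝕜 := 𝕜) hB hΦ k q
    exact ⟨t, mem_nhdsWithin_of_mem_nhds ht, h⟩

end CompactBounds

/-! ### Riemannian metrics in coordinates -/

section MetricInCoordinates

theorem chartSymmDeriv_injective {F : Type*} [NormedAddCommGroup F] [NormedSpace ℝ F]
    {H : Type*} [TopologicalSpace H] {I : ModelWithCorners ℝ F H} [I.Boundaryless]
    {N : Type*} [TopologicalSpace N] [ChartedSpace H N] [IsManifold I ∞ N] (p : N) {y : F}
    (hy : y ∈ (extChartAt I p).target) : Function.Injective (chartSymmDeriv I p y) := by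
  have h := isInvertible_mfderivWithin_extChartAt_symm (I := I) (x := p) hy
  rw [I.range_eq_univ, mfderivWithin_univ] at h
  exact h.injective

/-- The image of a constant vector field under the inverse of a chart is smooth. -/
theorem contMDiffOn_chartSymmDeriv {F : Type*} [NormedAddCommGroup F] [NormedSpace ℝ F]
    {H : Type*} [TopologicalSpace H] {I : ModelWithCorners ℝ F H} [I.Boundaryless]
    {N : Type*} [TopologicalSpace N] [ChartedSpace H N] [IsManifold I ∞ N] (p : N) (u : F) :
    ContMDiffOn 𝓘(ℝ, F) I.tangent ∞
      (fun y => (⟨(extChartAt I p).symm y, chartSymmDeriv I p y u⟩ : TangentBundle I N))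
      (extChartAt I p).target := by
  have hop := isOpen_extChartAt_target (I := I) p
  have h1 := (contMDiffOn_extChartAt_symm (I := I) (n := ∞) p).contMDiffOn_tangentMapWithin
    (m := ∞) (by simp) hop.uniqueMDiffOn
  have h2 : ContMDiff 𝓘(ℝ, F) 𝓘(ℝ, F).tangent ∞
      (fun y : F => (⟨y, u⟩ : TangentBundle 𝓘(ℝ, F) F)) :=
    contMDiff_vectorSpace_iff_contDiff.2 contDiff_const
  refine (h1.comp h2.contMDiffOn fun y hy => hy).congr fun y hy => ?_
  simp only [Function.comp_apply, tangentMapWithin, mfderivWithin_of_isOpen hop hy]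
  rfl

/-- The coordinate expression of a smooth field of bilinear forms is smooth. -/
theorem contDiffOn_chartMetric {F : Type*} [NormedAddCommGroup F] [NormedSpace ℝ F]
    [FiniteDimensional ℝ F] {H : Type*} [TopologicalSpace H] {I : ModelWithCorners ℝ F H}
    [I.Boundaryless] {N : Type*} [TopologicalSpace N] [ChartedSpace H N] [IsManifold I ∞ N]
    {B : ∀ q : N, TangentSpace I q →L[ℝ] TangentSpace I q →L[ℝ] ℝ}
    (hB : ContMDiff I (I.prod 𝓘(ℝ, F →L[ℝ] F →L[ℝ] ℝ)) ∞
      fun q => TotalSpace.mk' (F →L[ℝ] F →L[ℝ] ℝ)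
        (E := fun q : N => TangentSpace I q →L[ℝ] TangentSpace I q →L[ℝ] ℝ) q (B q)) (p : N) :
    ContDiffOn ℝ ∞ (chartMetric I B p) (extChartAt I p).target := by
  -- In finite dimension it suffices to evaluate on constant `u` and `w`, which turns the claim into
  -- applying a smooth section to two smooth vector fields along the inverse chart.
  rw [contDiffOn_clm_apply]
  intro u
  rw [contDiffOn_clm_apply]
  intro w y hy
  have h : ContMDiffWithinAt 𝓘(ℝ, F) (I.prod 𝓘(ℝ)) ∞
      (fun y => TotalSpace.mk' ℝ (E := Bundle.Trivial N ℝ) ((extChartAt I p).symm y)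
        (B ((extChartAt I p).symm y) (chartSymmDeriv I p y u) (chartSymmDeriv I p y w)))
      (extChartAt I p).target y :=
    ContMDiffWithinAt.clm_bundle_apply₂ (F₁ := F) (F₂ := F)
      ((hB.comp_contMDiffOn (contMDiffOn_extChartAt_symm p)) y hy)
      (contMDiffOn_chartSymmDeriv p u y hy) (contMDiffOn_chartSymmDeriv p w y hy)
  simp only [contMDiffWithinAt_totalSpace] at h
  exact h.2.contDiffWithinAt

variable {d : ℕ} {M : Type*} [TopologicalSpace M] [ChartedSpace (EuclideanSpace ℝ (Fin d)) M]
  [IsManifold (𝓡 d) ∞ M]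

/-- The coordinate expression of a Riemannian metric is a smooth metric. -/
theorem isSmoothMetricOn_chartMetric (g : Metric d M) (x : M) :
    IsSmoothMetricOn (chartMetric (𝓡 d) g.inner x) (extChartAt (𝓡 d) x).target where
  contDiffOn := contDiffOn_chartMetric g.contMDiff x
  symm y _ u w := g.symm ((extChartAt (𝓡 d) x).symm y) (chartSymmDeriv (𝓡 d) x y u)
    (chartSymmDeriv (𝓡 d) x y w)
  pos y hy u hu := by
    have hne : chartSymmDeriv (𝓡 d) x y u ≠ 0 := fun h0 =>
      hu (chartSymmDeriv_injective x hy (h0.trans (map_zero _).symm))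
    exact g.pos ((extChartAt (𝓡 d) x).symm y) (chartSymmDeriv (𝓡 d) x y u) hne

/-- The preferred chart of `M × M` at `p` is the product of those at `p.1` and `p.2`. The product
metric is therefore block diagonal in coordinates. -/
theorem chartSymmDeriv_prod (p : M × M) {y : EuclideanSpace ℝ (Fin d) × EuclideanSpace ℝ (Fin d)}
    (hy : y ∈ (extChartAt ((𝓡 d).prod (𝓡 d)) p).target) :
    chartSymmDeriv ((𝓡 d).prod (𝓡 d)) p y =
      (chartSymmDeriv (𝓡 d) p.1 y.1).prodMap (chartSymmDeriv (𝓡 d) p.2 y.2) := by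
  rw [extChartAt_prod, PartialEquiv.prod_target] at hy
  have d1 := mdifferentiableAt_extChartAt_symm p.1 hy.1
  have d2 := mdifferentiableAt_extChartAt_symm p.2 hy.2
  have e1 : MDifferentiableAt 𝓘(ℝ, EuclideanSpace ℝ (Fin d) × EuclideanSpace ℝ (Fin d))
      𝓘(ℝ, EuclideanSpace ℝ (Fin d)) Prod.fst y := differentiableAt_fst.mdifferentiableAt
  have e2 : MDifferentiableAt 𝓘(ℝ, EuclideanSpace ℝ (Fin d) × EuclideanSpace ℝ (Fin d))
      𝓘(ℝ, EuclideanSpace ℝ (Fin d)) Prod.snd y := differentiableAt_snd.mdifferentiableAt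
  have h := MDifferentiableAt.mfderiv_prod (d1.comp y e1) (d2.comp y e2)
  rw [mfderiv_comp y d1 e1, mfderiv_comp y d2 e2, mfderiv_eq_fderiv, mfderiv_eq_fderiv,
    fderiv_fst, fderiv_snd] at h
  have heq : (extChartAt ((𝓡 d).prod (𝓡 d)) p).symm =
      fun z => (((extChartAt (𝓡 d) p.1).symm ∘ Prod.fst) z,
        ((extChartAt (𝓡 d) p.2).symm ∘ Prod.snd) z) := by
    rw [extChartAt_prod]
    rfl
  rw [chartSymmDeriv, heq]
  exact h

theorem chartMetric_prod (g : Metric d M) (p : M × M)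
    {y : EuclideanSpace ℝ (Fin d) × EuclideanSpace ℝ (Fin d)}
    (hy : y ∈ (extChartAt ((𝓡 d).prod (𝓡 d)) p).target)
    (u w : EuclideanSpace ℝ (Fin d) × EuclideanSpace ℝ (Fin d)) :
    chartMetric ((𝓡 d).prod (𝓡 d)) (prodMetric g) p y u w =
      chartMetric (𝓡 d) g.inner p.1 y.1 u.1 w.1 + chartMetric (𝓡 d) g.inner p.2 y.2 u.2 w.2 := by
  rw [chartMetric_apply, chartSymmDeriv_prod p hy, extChartAt_prod]
  rfl

/-- The coordinate expression of the product metric is a smooth metric. -/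
theorem isSmoothMetricOn_chartMetric_prod (g : Metric d M) (p : M × M) :
    IsSmoothMetricOn (chartMetric ((𝓡 d).prod (𝓡 d)) (prodMetric g) p)
      (extChartAt ((𝓡 d).prod (𝓡 d)) p).target := by
  have h1 := isSmoothMetricOn_chartMetric g p.1
  have h2 := isSmoothMetricOn_chartMetric g p.2
  have hm : ∀ y ∈ (extChartAt ((𝓡 d).prod (𝓡 d)) p).target,
      y.1 ∈ (extChartAt (𝓡 d) p.1).target ∧ y.2 ∈ (extChartAt (𝓡 d) p.2).target := by
    intro y hy
    rw [extChartAt_prod, PartialEquiv.prod_target] at hy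
    exact hy
  refine ⟨?_, fun y hy u w => ?_, fun y hy u hu => ?_⟩
  · rw [contDiffOn_clm_apply]
    intro u
    rw [contDiffOn_clm_apply]
    intro w
    refine ContDiffOn.congr ?_ fun y hy => chartMetric_prod g p hy u w
    exact (((h1.contDiffOn.comp contDiffOn_fst fun y hy => (hm y hy).1).clm_apply
      contDiffOn_const).clm_apply contDiffOn_const).add
      (((h2.contDiffOn.comp contDiffOn_snd fun y hy => (hm y hy).2).clm_apply
      contDiffOn_const).clm_apply contDiffOn_const)
  · rw [chartMetric_prod g p hy, chartMetric_prod g p hy, h1.symm _ (hm y hy).1,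
      h2.symm _ (hm y hy).2]
  · rw [chartMetric_prod g p hy]
    have n1 : ∀ v, 0 ≤ chartMetric (𝓡 d) g.inner p.1 y.1 v v := fun v => by
      by_cases hv : v = 0
      · simp [hv]
      · exact (h1.pos _ (hm y hy).1 v hv).le
    have n2 : ∀ v, 0 ≤ chartMetric (𝓡 d) g.inner p.2 y.2 v v := fun v => by
      by_cases hv : v = 0
      · simp [hv]
      · exact (h2.pos _ (hm y hy).2 v hv).le
    by_cases hu1 : u.1 = 0
    · have hu2 : u.2 ≠ 0 := fun hu2 => hu (Prod.ext hu1 hu2)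
      exact add_pos_of_nonneg_of_pos (n1 _) (h2.pos _ (hm y hy).2 _ hu2)
    · exact add_pos_of_pos_of_nonneg (h1.pos _ (hm y hy).1 _ hu1) (n2 _)

/-- The Gram determinant of a Riemannian metric in coordinates is positive. -/
theorem det_chartMetric_pos (g : Metric d M) (x : M) {y : EuclideanSpace ℝ (Fin d)}
    (hy : y ∈ (extChartAt (𝓡 d) x).target) :
    0 < (Matrix.of fun i j : Fin d => chartMetric (𝓡 d) g.inner x y
      (EuclideanSpace.single i 1) (EuclideanSpace.single j 1)).det := by
  have hG := isSmoothMetricOn_chartMetric g x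
  refine Matrix.PosDef.det_pos (Matrix.PosDef.of_dotProduct_mulVec_pos ?_ ?_)
  · ext i j
    simp [hG.symm y hy (EuclideanSpace.single i 1)]
  · intro v hv
    have hsum : (WithLp.toLp 2 v : EuclideanSpace ℝ (Fin d)) =
        ∑ i, v i • EuclideanSpace.single i (1 : ℝ) := by
      ext j
      simp [Finset.sum_apply, Pi.single_apply]
    have hpos := hG.pos y hy (WithLp.toLp 2 v) (by simpa using hv)
    rw [hsum] at hpos
    simp only [map_sum, map_smul, sum_apply, smul_apply, smul_eq_mul, Finset.mul_sum] at hpos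
    simp only [dotProduct, Matrix.mulVec, star_trivial, Matrix.of_apply, Finset.mul_sum]
    rw [Finset.sum_comm]
    refine hpos.trans_le (Finset.sum_le_sum fun i _ => Finset.sum_le_sum fun j _ => le_of_eq ?_)
    ring

variable [MeasurableSpace M] [BorelSpace M]

/-- Nonempty open sets have positive Riemannian volume. -/
theorem isOpenPosMeasure_riemannianVolume (g : Metric d M) :
    (riemannianVolume g).IsOpenPosMeasure where
  open_pos := by
    rintro U hU ⟨x, hx⟩ h0
    have hle : chartVolume g x ≤ riemannianVolume g := le_iSup (chartVolume g) x
    have h0' : chartVolume g x U = 0 := le_antisymm ((hle U).trans h0.le) zero_le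
    have hop := isOpen_extChartAt_target (I := 𝓡 d) x
    have hG := isSmoothMetricOn_chartMetric g x
    have hsymm : AEMeasurable (extChartAt (𝓡 d) x).symm
        (volume.restrict (extChartAt (𝓡 d) x).target) :=
      (continuousOn_extChartAt_symm x).aemeasurable hop.measurableSet
    have hdens : ContinuousOn (fun y => ENNReal.ofReal (Real.sqrt (Matrix.of fun i j : Fin d =>
        chartMetric (𝓡 d) g.inner x y (EuclideanSpace.single i 1)
          (EuclideanSpace.single j 1)).det)) (extChartAt (𝓡 d) x).target := by
      refine ENNReal.continuous_ofReal.comp_continuousOn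
        (Real.continuous_sqrt.comp_continuousOn ?_)
      simp only [Matrix.det_apply, Matrix.of_apply]
      refine continuousOn_finsetSum _ fun σ _ => ContinuousOn.const_smul
        (continuousOn_finsetProd _ fun i _ => ?_) _
      exact (hG.contDiffOn.continuousOn.clm_apply continuousOn_const).clm_apply continuousOn_const
    rw [chartVolume, Measure.map_apply_of_aemeasurable
      (hsymm.mono_ac (withDensity_absolutelyContinuous _ _)) hU.measurableSet,
      withDensity_apply_eq_zero' (hdens.aemeasurable hop.measurableSet)] at h0'
    -- The density is nonzero on the chart target, so a null `U` would make the nonempty open set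
    -- `V` Lebesgue null.
    set V := (extChartAt (𝓡 d) x).target ∩ (extChartAt (𝓡 d) x).symm ⁻¹' U with hV
    have hVo : IsOpen V := (continuousOn_extChartAt_symm x).isOpen_inter_preimage hop hU
    have hVne : V.Nonempty := ⟨extChartAt (𝓡 d) x x, mem_extChartAt_target x, by
      simpa only [mem_preimage, extChartAt_to_inv] using hx⟩
    refine (hVo.measure_pos volume hVne).ne' ?_
    have hsub : V ∩ (extChartAt (𝓡 d) x).target = V := inter_eq_left.2 inter_subset_left
    rw [← hsub, ← Measure.restrict_apply hVo.measurableSet]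
    refine measure_mono_null ?_ h0'
    refine fun y hy => ⟨?_, hy.2⟩
    simpa using det_chartMetric_pos g x hy.1

end MetricInCoordinates

/-! ### Kernels of smoothing operators -/

section Kernels

variable {d : ℕ} {M : Type*} [TopologicalSpace M] [ChartedSpace (EuclideanSpace ℝ (Fin d)) M]
  [IsManifold (𝓡 d) ∞ M] [MeasurableSpace M] {𝕜 : Type*} [RCLike 𝕜] {g : Metric d M}

/-- The vector of `L²(M)` that represents the functional `u ↦ ∫ k(x, y) u(y) dy`. -/
def rowVec {k : M → M → 𝕜} (hk : ∀ x, MemLp (k x) 2 (riemannianVolume g)) (x : M) : L2 𝕜 g :=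
  (hk x).star.toLp

/-- The conjugate in `rowVec` undoes the conjugation in the first argument of the inner product. -/
theorem inner_rowVec {k : M → M → 𝕜} (hk : ∀ x, MemLp (k x) 2 (riemannianVolume g)) (x : M)
    (u : L2 𝕜 g) : inner 𝕜 (rowVec hk x) u = ∫ y, k x y * u y ∂riemannianVolume g := by
  rw [L2.inner_def]
  refine integral_congr_ae ?_
  filter_upwards [(hk x).star.coeFn_toLp] with y hy
  simp only [rowVec, hy, RCLike.inner_apply, Pi.star_apply, RCLike.star_def, RCLike.conj_conj]
  exact mul_comm _ _

variable {k k' : M → M → 𝕜} {A A' : L2 𝕜 g →L[𝕜] L2 𝕜 g}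

namespace IsIntegralOperatorIntoSmooth

theorem ae_eq_inner (h : IsIntegralOperatorIntoSmooth g k A) (u : L2 𝕜 g) :
    A u =ᵐ[riemannianVolume g] fun x => inner 𝕜 (rowVec h.memLp x) u := by
  simpa only [inner_rowVec] using h.ae_eq u

/-- Smoothness of all the functions `A u` is exactly weak smoothness of the row map, and weak
smoothness implies smoothness. -/
theorem contMDiff_rowVec (h : IsIntegralOperatorIntoSmooth g k A) :
    ContMDiff (𝓡 d) 𝓘(ℝ, L2 𝕜 g) ∞ (rowVec h.memLp) :=
  contMDiff_of_inner (𝕜 := 𝕜) fun u => by simpa only [inner_rowVec] using h.contMDiff u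

theorem add (h : IsIntegralOperatorIntoSmooth g k A) (h' : IsIntegralOperatorIntoSmooth g k' A') :
    IsIntegralOperatorIntoSmooth g (fun x y => k x y + k' x y) (A + A') := by
  have hint : ∀ (u : L2 𝕜 g) x, ∫ y, (k x y + k' x y) * u y ∂riemannianVolume g =
      (∫ y, k x y * u y ∂riemannianVolume g) + ∫ y, k' x y * u y ∂riemannianVolume g := by
    intro u x
    simp only [add_mul]
    exact integral_add ((h.memLp x).integrable_mul (Lp.memLp u))
      ((h'.memLp x).integrable_mul (Lp.memLp u))
  refine ⟨fun x => (h.memLp x).add (h'.memLp x), fun u => ?_, fun u => ?_⟩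
  · simp only [hint]
    filter_upwards [Lp.coeFn_add (A u) (A' u), h.ae_eq u, h'.ae_eq u] with x h1 h2 h3
    rw [add_apply, h1, Pi.add_apply, h2, h3]
  · simp only [hint]
    exact (h.contMDiff u).add (h'.contMDiff u)

/-- If `A` and its adjoint are integral operators into smooth functions, then so is `A R A` for
every bounded operator `R`. -/
theorem mul_mul (h : IsIntegralOperatorIntoSmooth g k A)
    (h' : IsIntegralOperatorIntoSmooth g k' (ContinuousLinearMap.adjoint A))
    (R : L2 𝕜 g →L[𝕜] L2 𝕜 g) :
    IsIntegralOperatorIntoSmooth g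
      (fun x y => inner 𝕜 (rowVec h.memLp x) (R (rowVec h'.memLp y))) (A * R * A) := by
  -- The kernel's row at `x` is the conjugate of `A* R* (a x)`, where `a x` is the row vector of
  -- `A`. This gives square integrability, and pairing it with `u` gives `A` applied to `R (A u)`.
  have hae : ∀ x, (fun y => inner 𝕜 (rowVec h.memLp x) (R (rowVec h'.memLp y)))
      =ᵐ[riemannianVolume g] star ⇑(ContinuousLinearMap.adjoint A
        (ContinuousLinearMap.adjoint R (rowVec h.memLp x))) := by
    intro x
    filter_upwards [h'.ae_eq_inner (ContinuousLinearMap.adjoint R (rowVec h.memLp x))] with y hy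
    rw [Pi.star_apply, hy, RCLike.star_def, inner_conj_symm, ContinuousLinearMap.adjoint_inner_left]
  have hint : ∀ (u : L2 𝕜 g) x, ∫ y, inner 𝕜 (rowVec h.memLp x) (R (rowVec h'.memLp y)) * u y
      ∂riemannianVolume g = ∫ y, k x y * (R (A u)) y ∂riemannianVolume g := by
    intro u x
    rw [← inner_rowVec h.memLp, ← ContinuousLinearMap.adjoint_inner_left,
      ← ContinuousLinearMap.adjoint_inner_left, L2.inner_def]
    refine integral_congr_ae ?_
    filter_upwards [hae x] with y hy
    rw [hy, RCLike.inner_apply, Pi.star_apply, RCLike.star_def, mul_comm]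
  refine ⟨fun x => ?_, fun u => ?_, fun u => ?_⟩
  · exact (memLp_congr_ae (hae x)).2 (Lp.memLp _).star
  · simp only [hint]
    exact h.ae_eq (R (A u))
  · simp only [hint]
    exact h.contMDiff (R (A u))

end IsIntegralOperatorIntoSmooth

variable {K K₁ K₂ : SmoothKernel 𝕜 d M}

/-- The kernel of a smoothing operator is unique. -/
theorem IsSmoothingKernel.unique [BorelSpace M] (h₁ : IsSmoothingKernel g K₁ A)
    (h₂ : IsSmoothingKernel g K₂ A) : K₁ = K₂ := by
  have := isOpenPosMeasure_riemannianVolume g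
  ext ⟨x, y⟩
  -- Both kernels give continuous representatives of `A u`, which agree everywhere since open sets
  -- have positive measure. The rows then agree in `L²` for every `x`, and continuity in `y`
  -- finishes.
  have hrow : rowVec h₁.self.memLp x = rowVec h₂.self.memLp x := by
    refine ext_inner_right 𝕜 fun u => ?_
    simp only [inner_rowVec]
    have hc := ((h₁.self.contMDiff u).continuous.ae_eq_iff_eq (riemannianVolume g)
      (h₂.self.contMDiff u).continuous).1 ((h₁.self.ae_eq u).symm.trans (h₂.self.ae_eq u))
    exact congrFun hc x
  have hae : (fun y => star (K₁ (x, y))) =ᵐ[riemannianVolume g] fun y => star (K₂ (x, y)) := by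
    have h1 := (h₁.self.memLp x).star.coeFn_toLp
    have h2 := (h₂.self.memLp x).star.coeFn_toLp
    exact h1.symm.trans (by
      change (rowVec h₁.self.memLp x : M → 𝕜) =ᵐ[riemannianVolume g] _
      rw [hrow]
      exact h2)
  have hcont : ∀ K : SmoothKernel 𝕜 d M, Continuous fun y => star (K (x, y)) := fun K =>
    (K.contMDiff.continuous.comp (Continuous.prodMk_right x)).star
  have := congrFun (((hcont K₁).ae_eq_iff_eq (riemannianVolume g) (hcont K₂)).1 hae) y
  exact star_injective this

theorem IsSmoothingKernel.add (h₁ : IsSmoothingKernel g K₁ A) (h₂ : IsSmoothingKernel g K₂ A') :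
    IsSmoothingKernel g (K₁ + K₂) (A + A') := by
  refine ⟨h₁.self.add h₂.self, ?_⟩
  have := h₁.adjoint.add h₂.adjoint
  rw [map_add]
  convert this using 3
  simp

/-- The kernel of `A R A`, for a smoothing operator `A` and a bounded operator `R`, as a functional
of `R`. -/
def sandwichFunctional (h : IsSmoothingKernel g K A) (p : M × M) :
    (L2 𝕜 g →L[𝕜] L2 𝕜 g) →L[𝕜] 𝕜 :=
  innerSL 𝕜 (rowVec h.self.memLp p.1) ∘L
    ContinuousLinearMap.apply 𝕜 (L2 𝕜 g) (rowVec h.adjoint.memLp p.2)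

theorem sandwichFunctional_apply (h : IsSmoothingKernel g K A) (p : M × M)
    (R : L2 𝕜 g →L[𝕜] L2 𝕜 g) : sandwichFunctional h p R =
      inner 𝕜 (rowVec h.self.memLp p.1) (R (rowVec h.adjoint.memLp p.2)) :=
  rfl

theorem contMDiff_sandwichFunctional_apply (h : IsSmoothingKernel g K A)
    (R : L2 𝕜 g →L[𝕜] L2 𝕜 g) :
    ContMDiff ((𝓡 d).prod (𝓡 d)) 𝓘(ℝ, 𝕜) ∞ fun p => sandwichFunctional h p R := by
  have hpair : ContMDiff ((𝓡 d).prod (𝓡 d)) 𝓘(ℝ, L2 𝕜 g × L2 𝕜 g) ∞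
      fun p : M × M => (rowVec h.self.memLp p.1, rowVec h.adjoint.memLp p.2) :=
    (h.self.contMDiff_rowVec.comp contMDiff_fst).prodMk_space
      (h.adjoint.contMDiff_rowVec.comp contMDiff_snd)
  have hinner : ContDiff ℝ ∞ fun q : L2 𝕜 g × L2 𝕜 g => inner 𝕜 q.1 (R q.2) :=
    contDiff_fst.inner 𝕜 ((R.restrictScalars ℝ).contDiff.comp contDiff_snd)
  exact hinner.contMDiff.comp hpair

/-- Smoothness for each single `R` becomes smoothness in the dual norm, which is what makes the
later estimates uniform in `R`. -/
theorem contMDiff_sandwichFunctional (h : IsSmoothingKernel g K A) :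
    ContMDiff ((𝓡 d).prod (𝓡 d)) 𝓘(ℝ, (L2 𝕜 g →L[𝕜] L2 𝕜 g) →L[𝕜] 𝕜) ∞
      (sandwichFunctional h) :=
  contMDiff_of_pointwise (contMDiff_sandwichFunctional_apply h)

/-- The kernel of `A R A`, for a smoothing operator `A` and a bounded operator `R`. -/
def sandwichKernel (h : IsSmoothingKernel g K A) (R : L2 𝕜 g →L[𝕜] L2 𝕜 g) :
    SmoothKernel 𝕜 d M :=
  ⟨fun p => sandwichFunctional h p R, contMDiff_sandwichFunctional_apply h R⟩

theorem sandwichKernel_apply (h : IsSmoothingKernel g K A) (R : L2 𝕜 g →L[𝕜] L2 𝕜 g)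
    (p : M × M) : sandwichKernel h R p = sandwichFunctional h p R :=
  rfl

/-- `A R A` is a smoothing operator if `A` is one and `R` is bounded. -/
theorem isSmoothingKernel_sandwichKernel (h : IsSmoothingKernel g K A)
    (R : L2 𝕜 g →L[𝕜] L2 𝕜 g) : IsSmoothingKernel g (sandwichKernel h R) (A * R * A) := by
  refine ⟨h.self.mul_mul h.adjoint R, ?_⟩
  -- The adjoint of `A R A` is `A* R* A*`, of the same form with `A*` in place of `A`, so `A** = A`
  -- supplies the remaining hypothesis.
  have hself : IsIntegralOperatorIntoSmooth g (fun x y => K (x, y))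
      (ContinuousLinearMap.adjoint (ContinuousLinearMap.adjoint A)) := by
    rw [ContinuousLinearMap.adjoint_adjoint]
    exact h.self
  have hadj : ContinuousLinearMap.adjoint (A * R * A) = ContinuousLinearMap.adjoint A *
      ContinuousLinearMap.adjoint R * ContinuousLinearMap.adjoint A := by
    simp only [← ContinuousLinearMap.star_eq_adjoint, star_mul, mul_assoc]
  rw [hadj]
  convert h.adjoint.mul_mul hself (ContinuousLinearMap.adjoint R) using 3 with x y
  rw [sandwichKernel_apply, sandwichFunctional_apply, inner_conj_symm,
    ContinuousLinearMap.adjoint_inner_right]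

/-- The seminorms of the kernels of `A R A` are bounded by the operator norm of `R`. -/
theorem exists_smoothSeminorm_sandwich_le (h : IsSmoothingKernel g K A) (k : ℕ)
    {U : Set (M × M)} (hU : IsCompact U) :
    ∃ C, 0 ≤ C ∧ ∀ R : L2 𝕜 g →L[𝕜] L2 𝕜 g,
      smoothSeminorm ((𝓡 d).prod (𝓡 d)) (prodMetric g) U k (fun p => sandwichFunctional h p R) ≤
        ENNReal.ofReal (C * ‖R‖) := by
  obtain ⟨C, hC, hle⟩ := exists_smoothSeminorm_le (𝕜 := 𝕜) (isSmoothMetricOn_chartMetric_prod g)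
    (contMDiff_sandwichFunctional h) k hU
  refine ⟨C, hC, fun R => ?_⟩
  -- Evaluation at `R` is a functional on the dual space, of norm at most `‖R‖`.
  let ev : ((L2 𝕜 g →L[𝕜] L2 𝕜 g) →L[𝕜] 𝕜) →L[ℝ] 𝕜 :=
    (ContinuousLinearMap.apply 𝕜 𝕜 R).restrictScalars ℝ
  have hev : ‖ev‖ ≤ ‖R‖ := ContinuousLinearMap.opNorm_le_bound _ (norm_nonneg _) fun φ => by
    rw [mul_comm]
    exact φ.le_opNorm R
  exact (hle ev).trans (ENNReal.ofReal_le_ofReal (by gcongr))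

end Kernels

/-! ### Powers of a smoothing operator and the Neumann series of kernels -/

section NeumannSeries

variable {d : ℕ} {M : Type*} [TopologicalSpace M] [ChartedSpace (EuclideanSpace ℝ (Fin d)) M]
  [IsManifold (𝓡 d) ∞ M] [MeasurableSpace M] {𝕜 : Type*} [RCLike 𝕜] {g : Metric d M}
  {S : L2 𝕜 g →L[𝕜] L2 𝕜 g} {K : SmoothKernel 𝕜 d M}

/-- One factor `S` is split off on each side, hence the shift by two; the first power keeps its
given kernel `K`. -/
theorem isSmoothingKernel_pow_add_two (h : IsSmoothingKernel g K S) (n : ℕ) :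
    IsSmoothingKernel g (sandwichKernel h (S ^ n)) (S ^ (n + 2)) := by
  have := isSmoothingKernel_sandwichKernel h (S ^ n)
  rwa [← pow_succ', ← pow_succ] at this

/-- The positive powers of a smoothing operator are smoothing operators. -/
theorem isSmoothing_pow (h : IsSmoothingKernel g K S) {n : ℕ} (hn : 1 ≤ n) :
    IsSmoothing g (S ^ n) := by
  obtain ⟨n, rfl⟩ := Nat.exists_eq_add_of_le' hn
  cases n with
  | zero => exact ⟨K, by simpa using h⟩
  | succ n => exact ⟨_, isSmoothingKernel_pow_add_two h n⟩

variable [BorelSpace M]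

/-- The partial sums of the series of the kernels of the powers of `S`. -/
theorem sum_kernel_pow_eq (h : IsSmoothingKernel g K S) {κ : ℕ → SmoothKernel 𝕜 d M}
    (hκ : ∀ n, 1 ≤ n → IsSmoothingKernel g (κ n) (S ^ n)) (l : ℕ) (p : M × M) :
    (∑ n ∈ Finset.Icc 1 (l + 1), κ n) p =
      K p + sandwichFunctional h p (∑ i ∈ Finset.range l, S ^ i) := by
  induction l with
  | zero =>
    have h1 : κ 1 = K := (hκ 1 le_rfl).unique (by simpa using h)
    simp [h1]
  | succ l ih =>
    have h2 : κ (l + 2) = sandwichKernel h (S ^ l) :=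
      (hκ (l + 2) (by omega)).unique (isSmoothingKernel_pow_add_two h l)
    rw [Finset.sum_Icc_succ_top (by omega), ContMDiffMap.coe_add, Pi.add_apply, ih, h2,
      sandwichKernel_apply, Finset.sum_range_succ, map_add, add_assoc]

/-- The series of the kernels of the powers of `S` converges in `C^∞(M × M)`. -/
theorem tendstoSmooth_sum_kernel_pow (h : IsSmoothingKernel g K S)
    {κ : ℕ → SmoothKernel 𝕜 d M} (hκ : ∀ n, 1 ≤ n → IsSmoothingKernel g (κ n) (S ^ n))
    {Q : L2 𝕜 g →L[𝕜] L2 𝕜 g} (hQ : HasSum (fun n : ℕ => S ^ n) Q)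
    (U : CompactExhaustion (M × M)) :
    TendstoSmooth g U (fun m => ∑ n ∈ Finset.Icc 1 m, κ n) (K + sandwichKernel h Q) := by
  intro j k
  obtain ⟨C, hC, hle⟩ := exists_smoothSeminorm_sandwich_le h k (U.isCompact j)
  -- Dropping the empty sum `m = 0` leaves `m = l + 1`: the term `n = 1` is `K`, and the terms `n =
  -- i + 2` with `i < l` are sandwiches.
  rw [← tendsto_add_atTop_iff_nat 1]
  have hlim : Tendsto (fun l : ℕ => ENNReal.ofReal (C * ‖∑ i ∈ Finset.range l, S ^ i - Q‖)) atTop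
      (𝓝 0) := by
    have h1 := (tendsto_iff_norm_sub_tendsto_zero.1 hQ.tendsto_sum_nat).const_mul C
    have h2 := ENNReal.tendsto_ofReal h1
    simpa using h2
  refine tendsto_of_tendsto_of_tendsto_of_le_of_le tendsto_const_nhds hlim
    (fun _ => zero_le) fun l => ?_
  -- `K` cancels, and by linearity the difference from the limit is the sandwich of `∑ S ^ i - Q`.
  refine le_trans (le_of_eq ?_) (hle (∑ i ∈ Finset.range l, S ^ i - Q))
  congr 1
  funext p
  rw [ContMDiffMap.coe_sub, Pi.sub_apply, sum_kernel_pow_eq h hκ, ContMDiffMap.coe_add,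
    Pi.add_apply, sandwichKernel_apply, map_sub]
  ring

end NeumannSeries

end NeumannSmoothing

end

theorem mainTheorem11 {𝕜 : Type*} [RCLike 𝕜] {d : ℕ} {M : Type*} [TopologicalSpace M]
    [ChartedSpace (EuclideanSpace ℝ (Fin d)) M] [IsManifold (𝓡 d) ∞ M]
    [T2Space M] [SecondCountableTopology M] [MeasurableSpace M] [BorelSpace M]
    (g : NeumannSmoothing.Metric d M)
    (S : NeumannSmoothing.L2 𝕜 g →L[𝕜] NeumannSmoothing.L2 𝕜 g)
    (hS : NeumannSmoothing.IsSmoothing g S) (hcomp : IsCompactOperator S) (hnorm : ‖S‖ < 1) :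
    (∀ n : ℕ, 1 ≤ n → ∃! K : NeumannSmoothing.SmoothKernel 𝕜 d M,
      NeumannSmoothing.IsSmoothingKernel g K (S ^ n)) ∧
    ∃ (S' : NeumannSmoothing.L2 𝕜 g →L[𝕜] NeumannSmoothing.L2 𝕜 g)
      (K' : NeumannSmoothing.SmoothKernel 𝕜 d M),
      (1 - S) * (1 + S') = 1 ∧ (1 + S') * (1 - S) = 1 ∧
      HasSum (fun n : ℕ => S ^ (n + 1)) S' ∧
      NeumannSmoothing.IsSmoothingKernel g K' S' ∧
      ∀ K : ℕ → NeumannSmoothing.SmoothKernel 𝕜 d M,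
        (∀ n : ℕ, 1 ≤ n → NeumannSmoothing.IsSmoothingKernel g (K n) (S ^ n)) →
        ∀ U : CompactExhaustion (M × M),
          NeumannSmoothing.TendstoSmooth g U (fun m => ∑ n ∈ Finset.Icc 1 m, K n) K' := by
  obtain ⟨K, h⟩ := hS
  refine ⟨fun n hn => ?_, ?_⟩
  · obtain ⟨κ, hκ⟩ := NeumannSmoothing.isSmoothing_pow h hn
    exact ⟨κ, hκ, fun κ' hκ' => hκ'.unique hκ⟩
  have hsum : Summable fun n : ℕ => S ^ n := summable_geometric_of_norm_lt_one hnorm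
  set Q := ∑' n : ℕ, S ^ n with hQdef
  have hQ : HasSum (fun n : ℕ => S ^ n) Q := hsum.hasSum
  have hl : (1 - S) * Q = 1 := mul_neg_geom_series S hnorm
  have hr : Q * (1 - S) = 1 := geom_series_mul_neg S hnorm
  have hQ' : 1 + S * Q = Q := by
    rw [sub_mul, one_mul] at hl
    rw [← hl, sub_add_cancel]
  -- The sum of the series is `S * Q`; inserting `Q = 1 + Q * S` writes it as `S` plus a sandwich,
  -- which provides its kernel.
  have hsand : S * Q = S + S * Q * S := by
    have : Q = 1 + Q * S := by
      rw [mul_sub, mul_one] at hr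
      rw [← hr, sub_add_cancel]
    rw [mul_assoc]
    nth_rw 1 [this]
    rw [mul_add, mul_one]
  refine ⟨S * Q, K + NeumannSmoothing.sandwichKernel h Q, by rw [hQ', hl], by rw [hQ', hr], ?_, ?_,
    fun κ hκ U => NeumannSmoothing.tendstoSmooth_sum_kernel_pow h hκ hQ U⟩
  · simpa only [pow_succ'] using hQ.mul_left S
  · rw [hsand]
    exact h.add (NeumannSmoothing.isSmoothingKernel_sandwichKernel h Q)
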